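/- Let $\nu$ be a $\sigma$-finite measure and let $f_0,f_1$ be probability densities with respect to $\nu$ whose Kullback–Leibler divergences $I_0=\int\log(f_0/f_1)\,f_0\,d\nu$ and $I_1=\int\log(f_1/f_0)\,f_1\,d\nu$ both lie in $(0,\infty)$. Let $\mathsf P_i$ be the law of a sequence $X_1,X_2,\dots$ of independent observations with common density $f_i$, $\mathsf E_i$ the corresponding expectation, $\mathcal F_n=\sigma(X_1,\dots,X_n)$, and $\bar\Lambda_n=\frac1n\sum_{k=1}^n\log\frac{f_1(X_k)}{f_0(X_k)}$. A test is a pair $(T,D)$ of an $\{\mathcal F_n\}_{n\ge1}$-stopping time $T\ge 1$ and an $\mathcal F_T$-measurable $D$ with values in $\{0,1\}$ ($D=1$ means that $H_0:f=f_0$ is rejected in favour of $H_1:f=f_1$). For $\alpha,\beta\in(0,1)$ let $\mathcal E(\alpha,\beta)$ be the class of tests with $\mathsf P_0(D=1)\le\alpha$ and $\mathsf P_1(D=0)\le\beta$, and let $\mathcal L_i(\alpha,\beta)=\inf_{(T,D)\in\mathcal E(\alpha,\beta)}\mathsf E_i[T]$, $i\in\{0,1\}$. For $a,b>0$ let $n^*(a,b)$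 be the smallest integer $n\ge1$ for which some $c\in\mathbb R$ satisfies $\mathsf P_0(\bar\Lambda_n>c)\le a$ and $\mathsf P_1(\bar\Lambda_n\le c)\le b$; for $a,b\in(0,1)$ let $c^*(a,b)$ be the smallest such $c$ when $n=n^*(a,b)$; and write $\mathsf{FSST}(a,b)=(n^*(a,b),c^*(a,b))$. General Multistage Test (GMT). Let $K_0,K_1\ge0$ be integers, let $N$ and $N_{i,j}$ ($i\in\{0,1\}$, $0\le j\le K_i$) be positive integers, and let $C$, $C_{i,j}$ be real thresholds, such that (A) $N_{i,0}\le N_{i,1}\le\dots\le N_{i,K_i}\le N$ for $i\in\{0,1\}$, and $C_{0,j}\le C_{1,k}$ whenever $N_{0,j}=N_{1,k}$. Unless it has stopped earlier, the GMT stops after $N_{0,j}$ observations and accepts $H_0$ if $\bar\Lambda_{N_{0,j}}\le C_{0,j}$, $0\le j\le K_0$; it stops after $N_{1,j}$ observations and rejects $H_0$ if $\bar\Lambda_{N_{1,j}}>C_{1,j}$, $0\le j\le K_1$; and it stops after $N$ observations, rejecting $H_0$ if and only if $\bar\Lambda_N>C$. If $N_{i,j}=N$, then $C_{i,j}$ is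 ignored. Design. For $\alpha,\beta\in(0,1)$ let $$\widehat K_0=\max\{j\ge0:\ n^*((\tfrac\beta4)^j,(\tfrac\beta4)^j)\le n^*(\tfrac\alpha4,\tfrac\beta4),\ (\tfrac\beta4)^j\ge\tfrac{3\alpha}4\},\qquad \widehat K_1=\max\{j\ge0:\ n^*((\tfrac\alpha4)^j,(\tfrac\alpha4)^j)\le n^*(\tfrac\alpha4,\tfrac\beta4),\ (\tfrac\alpha4)^j\ge\tfrac{3\beta}4\}.$$ Let $(\widehat T(\alpha,\beta),\widehat D(\alpha,\beta))$ be the sample size and the decision of the GMT with $K_i=\widehat K_i$, $(N,C)=\mathsf{FSST}(\frac\alpha4,\frac\beta4)$, $$(N_{0,j},C_{0,j})=\mathsf{FSST}\big((\tfrac\beta4)^j,(\tfrac\beta4)^j\big)\ (1\le j\le K_0),\qquad (N_{1,j},C_{1,j})=\mathsf{FSST}\big((\tfrac\alpha4)^j,(\tfrac\alpha4)^j\big)\ (1\le j\le K_1),$$ $$(N_{0,0},C_{0,0})=\mathsf{FSST}\Big(\gamma_{0,0},\ \tfrac{3\beta}4-\sum_{j=1}^{K_0}(\tfrac\beta4)^j\Big),\qquad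 (N_{1,0},C_{1,0})=\mathsf{FSST}\Big(\tfrac{3\alpha}4-\sum_{j=1}^{K_1}(\tfrac\alpha4)^j,\ \gamma_{1,0}\Big),$$ where $\gamma_{0,0}\in\big(\frac{(3\alpha)\vee\beta}4,1\big)$ and $\gamma_{1,0}\in\big(\frac{\alpha\vee(3\beta)}4,1\big)$ are functions of $(\alpha,\beta)\in(0,1)^2$. Put $\gamma_{0,j}=(\beta/4)^j$ and $\gamma_{1,j}=(\alpha/4)^j$ for $j\ge1$, and $$U_0=n^*\Big(\gamma_{0,0},\tfrac{3\beta}4-\sum_{j=1}^{K_0}(\tfrac\beta4)^j\Big)+\sum_{j=1}^{K_0}n^*\big(\gamma_{0,j},(\tfrac\beta4)^j\big)\gamma_{0,j-1}+n^*(\tfrac\alpha4,\tfrac\beta4)\,\gamma_{0,K_0},$$ $$U_1=n^*\Big(\tfrac{3\alpha}4-\sum_{j=1}^{K_1}(\tfrac\alpha4)^j,\gamma_{1,0}\Big)+\sum_{j=1}^{K_1}n^*\big((\tfrac\alpha4)^j,\gamma_{1,j}\big)\gamma_{1,j-1}+n^*(\tfrac\alpha4,\tfrac\beta4)\,\gamma_{1,K_1}.$$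 Assume that $\gamma_{0,0}$ is chosen so that it minimizes $U_0$ over its interval or, more generally, so that, as $\alpha,\beta\to0$ along those pairs $(\alpha,\beta)$ (if any) at which it is not such a minimizer, $\gamma_{0,0}\to0$ and $|\log\gamma_{0,0}|/|\log\beta|\to0$. Likewise assume that $\gamma_{1,0}$ is chosen so that it minimizes $U_1$ over its interval or, more generally, so that, as $\alpha,\beta\to0$ along those pairs (if any) at which it is not such a minimizer, $\gamma_{1,0}\to0$ and $|\log\gamma_{1,0}|/|\log\alpha|\to0$. (In particular, it is enough that these limits hold as $\alpha,\beta\to0$ without restriction.) Then, for all $\alpha,\beta\in(0,1)$, the parameters satisfy (A) and $(\widehat T(\alpha,\beta),\widehat D(\alpha,\beta))\in\mathcal E(\alpha,\beta)$; and, as $\alpha,\beta\to0$ jointly and at arbitrary rates, $$\mathsf E_0[\widehat T(\alpha,\beta)]\sim\mathcal L_0(\alpha,\beta)\qquad\text{and}\qquad\mathsf E_1[\widehat T(\alpha,\beta)]\sim\mathcal L_1(\alpha,\beta).$$ -/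

import Mathlib

open MeasureTheory ProbabilityTheory Filter Topology
open scoped ENNReal

/-- A probability density with respect to the measure `ν`. -/
structure ProbDensity {S : Type*} [MeasurableSpace S] (ν : Measure S) where
  toFun : S → ℝ
  measurable_toFun : Measurable toFun
  nonneg : ∀ x, 0 ≤ toFun x
  lintegral_eq_one : ∫⁻ x, ENNReal.ofReal (toFun x) ∂ν = 1

/-- The distribution of a single observation with density `g`. -/
noncomputable def ProbDensity.law {S : Type*} [MeasurableSpace S] {ν : Measure S}
    (g : ProbDensity ν) : Measure S :=
  ν.withDensity fun x => ENNReal.ofReal (g.toFun x)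

instance ProbDensity.isProbabilityMeasure_law {S : Type*} [MeasurableSpace S] {ν : Measure S}
    (g : ProbDensity ν) : IsProbabilityMeasure g.law :=
  ⟨by simp [ProbDensity.law, g.lintegral_eq_one]⟩

section BinaryTesting

variable {S : Type*} [MeasurableSpace S] {ν : Measure S}

/-- `P_i`, the distribution of the iid sequence `X = (X_1, X_2, …)` when the common density is
`f i`. A path is `ω : ℕ → S`, and the observation `X_n` is the coordinate `ω (n - 1)`. -/
noncomputable def pathLaw (f : Fin 2 → ProbDensity ν) (i : Fin 2) : Measure (ℕ → S) :=
  Measure.infinitePi fun _ : ℕ => (f i).law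

/-- `F_n`, the σ-algebra generated by the first `n` observations. -/
@[reducible] def obsSigma (S : Type*) [MeasurableSpace S] (n : ℕ) : MeasurableSpace (ℕ → S) :=
  MeasurableSpace.comap (fun (ω : ℕ → S) (k : Fin n) => ω k) MeasurableSpace.pi

/-- The log-likelihood ratio `Λ_n` of the first `n` observations. -/
noncomputable def logLR (f : Fin 2 → ProbDensity ν) (n : ℕ) (ω : ℕ → S) : ℝ :=
  ∑ k ∈ Finset.range n, Real.log ((f 1).toFun (ω k) / (f 0).toFun (ω k))

/-- The average log-likelihood ratio `Λ_n / n`. -/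
noncomputable def avgLLR (f : Fin 2 → ProbDensity ν) (n : ℕ) (ω : ℕ → S) : ℝ :=
  logLR f n ω / n

/-- `(T, D)` is a (sequential) test: `T` is a stopping time with values in `{1, 2, …} ∪ {∞}` and
`D` is an `F_T`-measurable random variable with values in `{0, 1}`; `D = 1` means that the null
hypothesis is rejected. -/
structure IsTest (T : (ℕ → S) → ℕ∞) (D : (ℕ → S) → Fin 2) : Prop where
  one_le : ∀ ω, 1 ≤ T ω
  measurable_decision : Measurable D
  measurableSet_stop : ∀ n : ℕ, MeasurableSet[obsSigma S n] {ω | T ω = n}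
  measurableSet_stop_decision : ∀ (n : ℕ) (i : Fin 2),
    MeasurableSet[obsSigma S n] {ω | T ω = n ∧ D ω = i}

/-- The class `E(α, β)` of the tests whose type-I and type-II error probabilities do not exceed
`α` and `β` respectively. -/
def testClass (f : Fin 2 → ProbDensity ν) (α β : ℝ) :
    Set (((ℕ → S) → ℕ∞) × ((ℕ → S) → Fin 2)) :=
  {χ | IsTest χ.1 χ.2 ∧
    (pathLaw f 0).real {ω | χ.2 ω = 1} ≤ α ∧ (pathLaw f 1).real {ω | χ.2 ω = 0} ≤ β}

/-- The expected sample size `E_i[T]`, an element of `[0, ∞]`. -/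
noncomputable def expSampleSize (f : Fin 2 → ProbDensity ν) (i : Fin 2)
    (T : (ℕ → S) → ℕ∞) : ℝ≥0∞ :=
  ∫⁻ ω, (T ω : ℝ≥0∞) ∂(pathLaw f i)

/-- `L_i(α, β)`, the optimal expected sample size under `P_i` in the class `E(α, β)`. -/
noncomputable def optSampleSize (f : Fin 2 → ProbDensity ν) (i : Fin 2) (α β : ℝ) : ℝ≥0∞ :=
  ⨅ χ ∈ testClass f α β, expSampleSize f i χ.1

/-- The family of tests `χ (α, β) ∈ E(α, β)`, `α, β ∈ (0, 1)`, is asymptotically optimal under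
`H_i`: `E_i[T(α, β)] ∼ L_i(α, β)` as `α, β → 0`, jointly and at arbitrary rates. -/
def IsAsympOptimal (f : Fin 2 → ProbDensity ν) (i : Fin 2)
    (χ : ℝ → ℝ → ((ℕ → S) → ℕ∞) × ((ℕ → S) → Fin 2)) : Prop :=
  (∀ α ∈ Set.Ioo (0 : ℝ) 1, ∀ β ∈ Set.Ioo (0 : ℝ) 1, χ α β ∈ testClass f α β) ∧
  Tendsto (fun p : ℝ × ℝ => expSampleSize f i (χ p.1 p.2).1 / optSampleSize f i p.1 p.2)
    (𝓝[>] 0 ×ˢ 𝓝[>] 0) (𝓝 1)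

/-! ### The fixed-sample-size test -/

/-- The fixed-sample-size test that rejects iff the average log-likelihood ratio at time `n`
exceeds `c` has error probabilities at most `a` and `b`. -/
def FixedTestControls (f : Fin 2 → ProbDensity ν) (a b : ℝ) (n : ℕ) (c : ℝ) : Prop :=
  (pathLaw f 0).real {ω | c < avgLLR f n ω} ≤ a ∧ (pathLaw f 1).real {ω | avgLLR f n ω ≤ c} ≤ b

/-- `n*(a, b)`, the smallest sample size of a fixed-sample-size test in `E(a, b)`. -/
noncomputable def nStar (f : Fin 2 → ProbDensity ν) (a b : ℝ) : ℕ :=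
  sInf {n : ℕ | 1 ≤ n ∧ ∃ c : ℝ, FixedTestControls f a b n c}

/-- `c*(a, b)`, the smallest threshold of such a test with sample size `n*(a, b)`. -/
noncomputable def cStar (f : Fin 2 → ProbDensity ν) (a b : ℝ) : ℝ :=
  sInf {c : ℝ | FixedTestControls f a b (nStar f a b) c}

/-! ### The General Multistage Test -/

/-- The parameters of the General Multistage Test. For `j ≤ K0`, the `(j+1)`-th opportunity to
accept the null hypothesis is after `N0 j` observations, with threshold `C0 j`; for `j ≤ K1`, the
`(j+1)`-th opportunity to reject it is after `N1 j` observations, with threshold `C1 j`; `N` is the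
maximum possible sample size and `C` the final threshold. -/
structure GMTParams where
  K0 : ℕ
  K1 : ℕ
  N : ℕ
  C : ℝ
  N0 : ℕ → ℕ
  C0 : ℕ → ℝ
  N1 : ℕ → ℕ
  C1 : ℕ → ℝ

/-- The requirements on the parameters: the stage sizes are positive and ordered,
`N_{i,0} ≤ N_{i,1} ≤ ⋯ ≤ N_{i,K_i} ≤ N`, and acceptance and rejection regions do not overlap. -/
structure GMTParams.IsAdmissible (p : GMTParams) : Prop where
  pos0 : 1 ≤ p.N0 0
  pos1 : 1 ≤ p.N1 0
  mono0 : ∀ j < p.K0, p.N0 j ≤ p.N0 (j + 1)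
  mono1 : ∀ j < p.K1, p.N1 j ≤ p.N1 (j + 1)
  le_max0 : p.N0 p.K0 ≤ p.N
  le_max1 : p.N1 p.K1 ≤ p.N
  no_overlap : ∀ j ≤ p.K0, ∀ k ≤ p.K1, p.N0 j = p.N1 k → p.C0 j ≤ p.C1 k

/-- The data call for acceptance of the null hypothesis after `n` observations. After `N`
observations only the threshold `C` is effective. -/
def GMTParams.Accepts (f : Fin 2 → ProbDensity ν) (p : GMTParams) (ω : ℕ → S) (n : ℕ) : Prop :=
  (n < p.N ∧ ∃ j ≤ p.K0, p.N0 j = n ∧ avgLLR f n ω ≤ p.C0 j) ∨ (n = p.N ∧ avgLLR f n ω ≤ p.C)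

/-- The data call for rejection of the null hypothesis after `n` observations. -/
def GMTParams.Rejects (f : Fin 2 → ProbDensity ν) (p : GMTParams) (ω : ℕ → S) (n : ℕ) : Prop :=
  (n < p.N ∧ ∃ j ≤ p.K1, p.N1 j = n ∧ p.C1 j < avgLLR f n ω) ∨ (n = p.N ∧ p.C < avgLLR f n ω)

/-- The sample size of the General Multistage Test (at most `N`, since at time `N` the data call
either for acceptance or for rejection). -/
noncomputable def GMTParams.sampleSize (f : Fin 2 → ProbDensity ν) (p : GMTParams)
    (ω : ℕ → S) : ℕ :=
  sInf {n : ℕ | p.Accepts f ω n ∨ p.Rejects f ω n}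

open Classical in
/-- The decision of the General Multistage Test. -/
noncomputable def GMTParams.decision (f : Fin 2 → ProbDensity ν) (p : GMTParams)
    (ω : ℕ → S) : Fin 2 :=
  if p.Rejects f ω (p.sampleSize f ω) then 1 else 0

/-- The General Multistage Test as a pair `(T, D)`. -/
noncomputable def GMTParams.test (f : Fin 2 → ProbDensity ν) (p : GMTParams) :
    ((ℕ → S) → ℕ∞) × ((ℕ → S) → Fin 2) :=
  (fun ω => (p.sampleSize f ω : ℕ∞), p.decision f)

/-- The error probability `3x/4 - ∑_{j=1}^K (x/4)^j` left for the first opportunity. -/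
noncomputable def remainingError (x : ℝ) (K : ℕ) : ℝ :=
  3 * x / 4 - ∑ j ∈ Finset.Icc 1 K, (x / 4) ^ j

/-- The active type-II (for `x = β`) or type-I (for `x = α`) error probability at the `(j+1)`-th
opportunity to accept or to reject, respectively, when there are `K` additional ones. -/
noncomputable def activeError (x : ℝ) (K j : ℕ) : ℝ :=
  if j = 0 then remainingError x K else (x / 4) ^ j

/-- The design of the General Multistage Test through fixed-sample-size tests, given
`γ_{0,j}`, `γ_{1,j}` (`j ≥ 0`), `K_0` and `K_1`. -/
noncomputable def gmtDesign (f : Fin 2 → ProbDensity ν) (α β : ℝ) (γ0 γ1 : ℕ → ℝ)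
    (K0 K1 : ℕ) : GMTParams where
  K0 := K0
  K1 := K1
  N := nStar f (α / 4) (β / 4)
  C := cStar f (α / 4) (β / 4)
  N0 j := nStar f (γ0 j) (activeError β K0 j)
  C0 j := cStar f (γ0 j) (activeError β K0 j)
  N1 j := nStar f (activeError α K1 j) (γ1 j)
  C1 j := cStar f (activeError α K1 j) (γ1 j)

/-- The upper bound on the expected sample size under `P_0`. -/
noncomputable def essBound0 (f : Fin 2 → ProbDensity ν) (α β : ℝ) (γ0 : ℕ → ℝ) (K0 : ℕ) : ℝ :=
  nStar f (γ0 0) (remainingError β K0)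
    + ∑ j ∈ Finset.Icc 1 K0, (nStar f (γ0 j) ((β / 4) ^ j) : ℝ) * γ0 (j - 1)
    + nStar f (α / 4) (β / 4) * γ0 K0

/-- The upper bound on the expected sample size under `P_1`. -/
noncomputable def essBound1 (f : Fin 2 → ProbDensity ν) (α β : ℝ) (γ1 : ℕ → ℝ) (K1 : ℕ) : ℝ :=
  nStar f (remainingError α K1) (γ1 0)
    + ∑ j ∈ Finset.Icc 1 K1, (nStar f ((α / 4) ^ j) (γ1 j) : ℝ) * γ1 (j - 1)
    + nStar f (α / 4) (β / 4) * γ1 K1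

/-- The sequence with value `g` at `0` and `(x/4)^j` at `j ≥ 1`: the inactive error probabilities
that match the active ones, apart from the first. -/
noncomputable def matchedSeq (g x : ℝ) (j : ℕ) : ℝ :=
  if j = 0 then g else (x / 4) ^ j

/-- The number `K̂_0` of additional opportunities to accept the null hypothesis. -/
noncomputable def KHat0 (f : Fin 2 → ProbDensity ν) (α β : ℝ) : ℕ :=
  sSup {j : ℕ | nStar f ((β / 4) ^ j) ((β / 4) ^ j) ≤ nStar f (α / 4) (β / 4) ∧
    3 * α / 4 ≤ (β / 4) ^ j}

/-- The number `K̂_1` of additional opportunities to reject the null hypothesis. -/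
noncomputable def KHat1 (f : Fin 2 → ProbDensity ν) (α β : ℝ) : ℕ :=
  sSup {j : ℕ | nStar f ((α / 4) ^ j) ((α / 4) ^ j) ≤ nStar f (α / 4) (β / 4) ∧
    3 * β / 4 ≤ (α / 4) ^ j}

/-- The parameters of the General Multistage Test with `K_i = K̂_i`, matched inactive error
probabilities, and first inactive error probabilities `g0 = γ_{0,0}` and `g1 = γ_{1,0}`. -/
noncomputable def gmtHat (f : Fin 2 → ProbDensity ν) (α β g0 g1 : ℝ) : GMTParams :=
  gmtDesign f α β (matchedSeq g0 β) (matchedSeq g1 α) (KHat0 f α β) (KHat1 f α β)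

/-- The value `g = γ_{0,0}` minimizes the upper bound on the expected sample size under `P_0` over
the interval `((3α ∨ β)/4, 1)`. -/
def MinimizesBound0 (f : Fin 2 → ProbDensity ν) (α β g : ℝ) : Prop :=
  IsMinOn (fun x => essBound0 f α β (matchedSeq x β) (KHat0 f α β))
    (Set.Ioo (max (3 * α) β / 4) 1) g

/-- The value `g = γ_{1,0}` minimizes the upper bound on the expected sample size under `P_1` over
the interval `((α ∨ 3β)/4, 1)`. -/
def MinimizesBound1 (f : Fin 2 → ProbDensity ν) (α β g : ℝ) : Prop :=
  IsMinOn (fun x => essBound1 f α β (matchedSeq x α) (KHat1 f α β))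
    (Set.Ioo (max α (3 * β) / 4) 1) g

/-- `α, β → 0` within the set of those pairs `(α, β)`, `α, β > 0`, that do not satisfy `M`. If `M`
never holds this is `α, β → 0` at arbitrary rates; if `M` always holds, every limit statement along
this filter is void. -/
def smallOutside (M : ℝ → ℝ → Prop) : Filter (ℝ × ℝ) :=
  (𝓝[>] 0 ×ˢ 𝓝[>] 0) ⊓ 𝓟 {p | ¬ M p.1 p.2}

end BinaryTesting

/-! Both expected sample sizes are squeezed onto an explicit scale: `|log β| / I0` under the null
and, with the hypotheses exchanged, `|log α| / I1` under the alternative. Finite divergences in both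
directions make each law an exponential tilt of the other by the log-likelihood ratio
(`TiltedPair`). The probabilistic estimates for a generic pair thus serve both hypotheses, the
second after a change of sign.

Lower bound, for every test in the class. Up to a time `m` slightly below `|log β| / I0`, the strong
law keeps the log-likelihood ratio above `-(1 + e) * I0 * m`, apart from an event of small
`P_0`-probability. On the remaining event, stopping by `m` and accepting has `P_0`-probability at
most `exp ((1 + e) * I0 * m)` times its `P_1`-probability, and the latter is at most `β`. Stopping
by `m` and rejecting has probability at most `α`. So `T > m` with probability near one
(`TiltedPair.measure_stop_le`, `TiltedPair.exists_le_lintegral_of_isTest`).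

Upper bound. The test passes a given acceptance stage only if acceptance failed there, which under
`P_0` has probability at most the type-I level of that stage; weighting each size by the level
before it gives `essBound0` (`lintegral_le_of_stages`). The first size is at most about `|log β| /
I0` as long as `log γ00` is negligible against `log β`: with a threshold just above the drift `-I0`,
the type-II error decays at a rate close to `I0` and the type-I error still decays exponentially
(`TiltedPair.exists_tails_le`). Stage `j` costs at most `j` times the order of `|log β|`, and
maximality of the number of stages bounds the final size by `K + 2` times that order, however small
`α` is compared with `β` (`exists_nStar_stage_le`). The geometric weights sum all this to `O(|log
β|) * (γ00 + β)`, which is negligible. Where `γ00` is a minimizer, its bound is at most the one at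
an explicit comparison point (`exists_comparison`).

The error constraints follow from a union bound over the stages. The ordering requirements follow
from monotonicity of `nStar` and from `cStar` being the least threshold that meets the type-I
constraint. -/

/-! ### Partial sums along an iid path: Chernoff bounds and change of measure. -/

section Sampling

/-- The partial sum `Y(ω 0) + ⋯ + Y(ω (n-1))` along a path. -/
noncomputable def pathSum {S : Type*} (Y : S → ℝ) (n : ℕ) (ω : ℕ → S) : ℝ :=
  ∑ k ∈ Finset.range n, Y (ω k)

variable {S : Type*} [MeasurableSpace S]

lemma measurable_pathSum {Y : S → ℝ} (hY : Measurable Y) (n : ℕ) :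
    Measurable (pathSum Y n) := by
  unfold pathSum
  fun_prop

lemma pathSum_neg {S : Type*} (Y : S → ℝ) (n : ℕ) (ω : ℕ → S) :
    pathSum (fun x => - Y x) n ω = - pathSum Y n ω := by
  simp [pathSum]

lemma obsSigma_le (n : ℕ) : obsSigma S n ≤ MeasurableSpace.pi := by
  rintro _ ⟨B, hB, rfl⟩
  exact (by fun_prop : Measurable fun (ω : ℕ → S) (k : Fin n) => ω k) hB

lemma measurable_obsSigma_pathSum {Y : S → ℝ} (hY : Measurable Y) {m n : ℕ} (hmn : m ≤ n) :
    Measurable[obsSigma S n] (pathSum Y m) := by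
  refine Finset.measurable_sum _ fun k hk => hY.comp ?_
  have hk' : k < n := (Finset.mem_range.1 hk).trans_le hmn
  have h1 : Measurable[obsSigma S n] (fun (ω : ℕ → S) (j : Fin n) => ω j) :=
    comap_measurable _
  exact (measurable_pi_apply (⟨k, hk'⟩ : Fin n)).comp h1

lemma iIndepFun_path (μ : Measure S) [IsProbabilityMeasure μ] {Y : S → ℝ} (hY : Measurable Y) :
    iIndepFun (fun (k : ℕ) (ω : ℕ → S) => Y (ω k)) (Measure.infinitePi fun _ : ℕ => μ) :=
  iIndepFun_infinitePi (P := fun _ : ℕ => μ) (X := fun _ => Y) fun _ => hY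

lemma identDistrib_path (μ : Measure S) [IsProbabilityMeasure μ] {Y : S → ℝ} (hY : Measurable Y)
    (k : ℕ) :
    IdentDistrib (fun ω : ℕ → S => Y (ω k)) Y (Measure.infinitePi fun _ : ℕ => μ) μ where
  aemeasurable_fst := (hY.comp (measurable_pi_apply k)).aemeasurable
  aemeasurable_snd := hY.aemeasurable
  map_eq := by
    have h := Measure.infinitePi_map_eval (fun _ : ℕ => μ) k
    conv_rhs => rw [← h, Measure.map_map hY (by fun_prop)]
    rfl

/-! ### Chernoff bounds -/

/-- Markov's inequality for the exponential of the sum, whose mean factorises by independence. -/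
lemma pathSum_tail_le (μ : Measure S) [IsProbabilityMeasure μ] {Y : S → ℝ} (hY : Measurable Y)
    {θ : ℝ} (hθ : 0 ≤ θ) (hint : Integrable (fun x => Real.exp (θ * Y x)) μ) (t : ℝ) (n : ℕ) :
    (Measure.infinitePi fun _ : ℕ => μ).real {ω | n * t ≤ pathSum Y n ω}
      ≤ (Real.exp (-(θ * t)) * mgf Y μ θ) ^ n := by
  have hI := iIndepFun_path μ hY
  have hd := identDistrib_path μ hY
  have hm : ∀ k : ℕ, Measurable fun ω : ℕ → S => Y (ω k) := fun k => by fun_prop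
  have hik : ∀ k : ℕ, Integrable (fun ω : ℕ → S => Real.exp (θ * Y (ω k)))
      (Measure.infinitePi fun _ : ℕ => μ) := fun k =>
    ((hd k).comp (u := fun y : ℝ => Real.exp (θ * y)) (by fun_prop)).integrable_iff.2 hint
  have h1 := hI.integrable_exp_mul_sum (t := θ) hm (s := Finset.range n) (fun k _ => hik k)
  have h2 := measure_ge_le_exp_mul_mgf (n * t) hθ h1
  rw [hI.mgf_sum hm] at h2
  have h3 : ∀ k : ℕ, mgf (fun ω : ℕ → S => Y (ω k))
      (Measure.infinitePi fun _ : ℕ => μ) θ = mgf Y μ θ := fun k =>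
    mgf_congr_of_identDistrib _ _ (hd k) _
  simp only [h3, Finset.prod_const, Finset.card_range, Finset.sum_apply] at h2
  refine h2.trans_eq ?_
  rw [mul_pow, ← Real.exp_nat_mul]
  ring_nf

lemma integrable_exp_mul_of_mem_Icc {μ : Measure S} [IsProbabilityMeasure μ] {Y : S → ℝ}
    (hY : Measurable Y) (hexp : Integrable (fun x => Real.exp (Y x)) μ) {θ : ℝ} (h0 : 0 ≤ θ)
    (h1 : θ ≤ 1) : Integrable (fun x => Real.exp (θ * Y x)) μ := by
  refine (hexp.add (integrable_const (1 : ℝ))).mono' (by fun_prop) (ae_of_all _ fun x => ?_)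
  rw [Real.norm_of_nonneg (Real.exp_pos _).le]
  simp only [Pi.add_apply]
  rcases le_total 0 (Y x) with h | h
  · have : Real.exp (θ * Y x) ≤ Real.exp (Y x) := Real.exp_le_exp.2 (by nlinarith)
    linarith
  · have : Real.exp (θ * Y x) ≤ 1 := Real.exp_le_one_iff.2 (mul_nonpos_of_nonneg_of_nonpos h0 h)
    linarith [Real.exp_pos (Y x)]

/-- A majorant, uniform in `θ`, for differentiating the moment generating function at `0` from the
right. The lower estimate is `1 + u ≤ exp u`; the upper one is convexity of `exp` between `0` and
`y`. -/
lemma abs_exp_mul_sub_one_div_le {θ y : ℝ} (h0 : 0 < θ) (h1 : θ ≤ 1) :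
    |(Real.exp (θ * y) - 1) / θ| ≤ |y| + Real.exp y + 1 := by
  have hlow : y ≤ (Real.exp (θ * y) - 1) / θ := by
    rw [le_div_iff₀ h0]
    linarith [Real.add_one_le_exp (θ * y)]
  have hup : (Real.exp (θ * y) - 1) / θ ≤ Real.exp y - 1 := by
    rw [div_le_iff₀ h0]
    have hc := convexOn_exp.2 (Set.mem_univ (0 : ℝ)) (Set.mem_univ y) (sub_nonneg.2 h1) h0.le
      (by ring)
    simp only [smul_eq_mul, mul_zero, zero_add, Real.exp_zero, mul_one] at hc
    linarith
  rw [abs_le]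
  constructor
  · linarith [neg_abs_le y, Real.exp_pos y]
  · linarith [abs_nonneg y]

/-- The right derivative of `mgf Y μ` at `0` is the mean, so `mgf Y μ θ < 1 + θ * t ≤ exp (θ * t)`
for some small `θ > 0`. Exponential moments are needed on the positive side only. -/
lemma exists_exp_mul_mgf_lt_one {μ : Measure S} [IsProbabilityMeasure μ] {Y : S → ℝ}
    (hY : Measurable Y) (hint : Integrable Y μ) (hexp : Integrable (fun x => Real.exp (Y x)) μ)
    {t : ℝ} (ht : ∫ x, Y x ∂μ < t) :
    ∃ θ ∈ Set.Ioc (0 : ℝ) 1, Real.exp (-(θ * t)) * mgf Y μ θ < 1 := by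
  have hlim : Tendsto (fun θ : ℝ => ∫ x, (Real.exp (θ * Y x) - 1) / θ ∂μ) (𝓝[>] 0)
      (𝓝 (∫ x, Y x ∂μ)) := by
    refine tendsto_integral_filter_of_dominated_convergence
      (fun x => |Y x| + Real.exp (Y x) + 1) (Eventually.of_forall fun θ => by fun_prop) ?_
      ((hint.abs.add hexp).add (integrable_const _)) (ae_of_all _ fun x => ?_)
    · filter_upwards [Ioc_mem_nhdsGT (zero_lt_one' ℝ)] with θ hθ
      exact ae_of_all _ fun x => abs_exp_mul_sub_one_div_le hθ.1 hθ.2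
    · have hd : HasDerivAt (fun θ : ℝ => Real.exp (θ * Y x)) (Y x) 0 := by
        simpa using ((hasDerivAt_id (0 : ℝ)).mul_const (Y x)).exp
      have := (hasDerivAt_iff_tendsto_slope.1 hd).mono_left
        (nhdsWithin_mono 0 fun θ (hθ : (0 : ℝ) < θ) => hθ.ne')
      refine this.congr fun θ => ?_
      simp [slope_def_field]
  obtain ⟨θ, hθt, hθ⟩ := ((hlim.eventually_lt_const ht).and
    (Ioc_mem_nhdsGT (zero_lt_one' ℝ))).exists
  refine ⟨θ, hθ, ?_⟩
  have hi := integrable_exp_mul_of_mem_Icc hY hexp hθ.1.le hθ.2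
  rw [integral_div, integral_sub hi (integrable_const _), div_lt_iff₀ hθ.1] at hθt
  simp only [integral_const, probReal_univ, one_smul] at hθt
  have hm : mgf Y μ θ < 1 + θ * t := by
    unfold mgf
    linarith
  calc Real.exp (-(θ * t)) * mgf Y μ θ < Real.exp (-(θ * t)) * (1 + θ * t) := by gcongr
    _ ≤ Real.exp (-(θ * t)) * Real.exp (θ * t) := by
      gcongr
      linarith [Real.add_one_le_exp (θ * t)]
    _ = 1 := by rw [← Real.exp_add]; simp

lemma exists_pathSum_tail_le_exp {μ : Measure S} [IsProbabilityMeasure μ] {Y : S → ℝ}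
    (hY : Measurable Y) (hint : Integrable Y μ) (hexp : Integrable (fun x => Real.exp (Y x)) μ)
    {t : ℝ} (ht : ∫ x, Y x ∂μ < t) :
    ∃ r > 0, ∀ n : ℕ, (Measure.infinitePi fun _ : ℕ => μ).real {ω | n * t ≤ pathSum Y n ω}
      ≤ Real.exp (-(r * n)) := by
  obtain ⟨θ, hθ, h1⟩ := exists_exp_mul_mgf_lt_one hY hint hexp ht
  have hi := integrable_exp_mul_of_mem_Icc hY hexp hθ.1.le hθ.2
  have hpos : 0 < Real.exp (-(θ * t)) * mgf Y μ θ := mul_pos (Real.exp_pos _) (mgf_pos hi)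
  refine ⟨-Real.log (Real.exp (-(θ * t)) * mgf Y μ θ), neg_pos.2 (Real.log_neg hpos h1),
    fun n => (pathSum_tail_le μ hY hθ.1.le hi t n).trans_eq ?_⟩
  rw [neg_mul, neg_neg, mul_comm (Real.log _), Real.exp_nat_mul, Real.exp_log hpos]

/-! ### Pairs of laws with a finite log-likelihood ratio -/

/-- The law `η` has density `exp Y` with respect to the law `μ`, and `Y` has mean `-I < 0` under
`μ`. -/
structure TiltedPair (μ η : Measure S) (Y : S → ℝ) (I : ℝ) : Prop where
  measurable : Measurable Y
  integrable : Integrable Y μ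
  integral_eq : ∫ x, Y x ∂μ = -I
  pos : 0 < I
  withDensity_eq : η = μ.withDensity fun x => ENNReal.ofReal (Real.exp (Y x))

namespace TiltedPair

variable {μ η : Measure S} {Y : S → ℝ} {I : ℝ}

lemma lintegral_exp (h : TiltedPair μ η Y I) (s : Set S) (hs : MeasurableSet s) :
    ∫⁻ x in s, ENNReal.ofReal (Real.exp (Y x)) ∂μ = η s := by
  rw [h.withDensity_eq, withDensity_apply _ hs]

variable [IsProbabilityMeasure η]

lemma integrable_exp (h : TiltedPair μ η Y I) : Integrable (fun x => Real.exp (Y x)) μ := by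
  have hY := h.measurable
  refine ⟨by fun_prop, ?_⟩
  have := h.lintegral_exp Set.univ MeasurableSet.univ
  rw [Measure.restrict_univ, measure_univ] at this
  rw [hasFiniteIntegral_iff_ofReal (ae_of_all _ fun x => (Real.exp_pos _).le), this]
  exact ENNReal.one_lt_top

variable [IsProbabilityMeasure μ]

lemma exists_tail_le_exp (h : TiltedPair μ η Y I) {t : ℝ} (ht : -I < t) :
    ∃ r > 0, ∀ n : ℕ, (Measure.infinitePi fun _ : ℕ => μ).real {ω | n * t ≤ pathSum Y n ω}
      ≤ Real.exp (-(r * n)) :=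
  exists_pathSum_tail_le_exp h.measurable h.integrable h.integrable_exp
    (by rw [h.integral_eq]; exact ht)

/-- The Chernoff bound at `θ = 1`, where the moment generating function equals `1` because `exp Y`
is a probability density. The exponent is therefore explicit. -/
lemma tail_le_exp (h : TiltedPair μ η Y I) (t : ℝ) (n : ℕ) :
    (Measure.infinitePi fun _ : ℕ => μ).real {ω | n * t ≤ pathSum Y n ω}
      ≤ Real.exp (-(n * t)) := by
  have hY := h.measurable
  have hmgf : mgf Y μ 1 = 1 := by
    have := h.lintegral_exp Set.univ MeasurableSet.univ
    rw [Measure.restrict_univ, measure_univ,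
      ← ofReal_integral_eq_lintegral_ofReal h.integrable_exp
        (ae_of_all _ fun x => (Real.exp_pos _).le), ENNReal.ofReal_eq_one] at this
    simpa [mgf] using this
  have := pathSum_tail_le μ hY zero_le_one (by simpa using h.integrable_exp) t n
  rw [hmgf, mul_one, one_mul, ← Real.exp_nat_mul] at this
  simpa using this

/-- Change of measure on the σ-algebra of the first `n` observations. -/
lemma infinitePi_apply (h : TiltedPair μ η Y I) {n : ℕ} {A : Set (ℕ → S)}
    (hA : MeasurableSet[obsSigma S n] A) :
    Measure.infinitePi (fun _ : ℕ => η) A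
      = ∫⁻ ω in A, ENNReal.ofReal (Real.exp (pathSum Y n ω))
        ∂(Measure.infinitePi fun _ : ℕ => μ) := by
  have hY := h.measurable
  set P := Measure.infinitePi fun _ : ℕ => μ
  set Q := Measure.infinitePi fun _ : ℕ => η
  let proj : (ℕ → S) → (Fin n → S) := fun ω k => ω k
  have hproj : Measurable proj := by fun_prop
  obtain ⟨B, hB, rfl⟩ := hA
  -- The two measures on the first `n` coordinates agree with the same product measure. For the
  -- tilted one this is checked on boxes, where the density splits into independent factors.
  have hQ : Measure.pi (fun _ : Fin n => η) = Q.map proj := by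
    rw [← Measure.infinitePi_eq_pi]
    exact (Measure.map_infinitePi_infinitePi_of_inj (P := fun _ : ℕ => η)
      (f := fun k : Fin n => (k : ℕ)) Fin.val_injective).symm
  have hP : Measure.pi (fun _ : Fin n => η)
      = (P.withDensity fun ω => ENNReal.ofReal (Real.exp (pathSum Y n ω))).map proj := by
    refine Measure.pi_eq fun s hs => ?_
    have hbox : MeasurableSet (proj ⁻¹' Set.univ.pi s) := hproj (.univ_pi hs)
    rw [Measure.map_apply hproj (.univ_pi hs), withDensity_apply _ hbox,
      ← lintegral_indicator hbox]
    let g : Fin n → S → ℝ≥0∞ := fun k =>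
      (s k).indicator fun x => ENNReal.ofReal (Real.exp (Y x))
    have hg : ∀ k, Measurable (g k) := fun k => Measurable.indicator (by fun_prop) (hs k)
    have hind : iIndepFun (fun (k : Fin n) (ω : ℕ → S) => g k (ω k)) P :=
      ((iIndepFun_infinitePi (P := fun _ : ℕ => μ) (X := fun _ => id)
        fun _ => measurable_id).precomp (g := fun k : Fin n => (k : ℕ))
        Fin.val_injective).comp g hg
    have hprod := lintegral_prod_eq_prod_lintegral_of_indepFun Finset.univ _ hind
      fun k => (hg k).comp (measurable_pi_apply _)
    refine Eq.trans (lintegral_congr fun ω => ?_) (hprod.trans (Finset.prod_congr rfl fun k _ => ?_))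
    · by_cases hω : ω ∈ proj ⁻¹' Set.univ.pi s
      · rw [Set.indicator_of_mem hω, pathSum, Real.exp_sum,
          ENNReal.ofReal_prod_of_nonneg fun _ _ => (Real.exp_pos _).le, Finset.prod_range]
        refine Finset.prod_congr rfl fun k _ => ?_
        have : ω k ∈ s k := hω k (Set.mem_univ _)
        simp [g, this]
      · rw [Set.indicator_of_notMem hω]
        simp only [Set.mem_preimage, Set.mem_pi, Set.mem_univ, true_implies, not_forall] at hω
        obtain ⟨k, hk⟩ := hω
        refine (Finset.prod_eq_zero (Finset.mem_univ k) ?_).symm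
        exact Set.indicator_of_notMem hk _
    · rw [← h.lintegral_exp _ (hs k), ← lintegral_indicator (hs k)]
      conv_rhs => rw [← Measure.infinitePi_map_eval (fun _ : ℕ => μ) k]
      rw [lintegral_map (hg k) (measurable_pi_apply _)]
  have hB' := hproj hB
  rw [← Measure.map_apply hproj hB, ← hQ, hP, Measure.map_apply hproj hB, withDensity_apply _ hB']

end TiltedPair

end Sampling

/-! ### The lower bound on the expected sample size of an arbitrary test. -/

section LowerBound

variable {S : Type*} [MeasurableSpace S]

namespace TiltedPair

variable {μ η : Measure S} [IsProbabilityMeasure μ] {Y : S → ℝ} {I : ℝ}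

lemma tendsto_pathSum_div (h : TiltedPair μ η Y I) :
    ∀ᵐ ω ∂(Measure.infinitePi fun _ : ℕ => μ),
      Tendsto (fun n : ℕ => pathSum Y n ω / n) atTop (𝓝 (-I)) := by
  have hd := identDistrib_path μ h.measurable
  have hslln := strong_law_ae_real (μ := Measure.infinitePi fun _ : ℕ => μ)
    (fun (k : ℕ) (ω : ℕ → S) => Y (ω k)) ((hd 0).integrable_iff.2 h.integrable)
    (fun i j hij => (iIndepFun_path μ h.measurable).indepFun hij)
    (fun i => (hd i).trans (hd 0).symm)
  rw [(hd 0).integral_eq, h.integral_eq] at hslln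
  exact hslln

/-- The probability that the partial sums fall below a line steeper than their drift, at any
time up to `m`, vanishes as `m` grows. -/
lemma tendsto_measure_exists_pathSum_lt (h : TiltedPair μ η Y I) {c : ℝ} (hc : I < c) :
    Tendsto (fun m : ℕ => Measure.infinitePi (fun _ : ℕ => μ)
      {ω | ∃ k ≤ m, pathSum Y k ω < -(c * m)}) atTop (𝓝 0) := by
  have hmeas : ∀ m : ℕ, MeasurableSet {ω : ℕ → S | ∃ k ≤ m, pathSum Y k ω < -(c * m)} := by
    intro m
    have : {ω : ℕ → S | ∃ k ≤ m, pathSum Y k ω < -(c * m)}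
        = ⋃ k ≤ m, {ω | pathSum Y k ω < -(c * m)} := by ext; simp
    rw [this]
    exact .iUnion fun k => .iUnion fun _ =>
      measurableSet_lt (measurable_pathSum h.measurable k) measurable_const
  have hcpos : 0 < c := h.pos.trans hc
  rw [← measure_empty (μ := Measure.infinitePi fun _ : ℕ => μ)]
  refine tendsto_measure_of_ae_tendsto_indicator_of_isFiniteMeasure _ .empty hmeas ?_
  filter_upwards [h.tendsto_pathSum_div] with ω hω
  -- On a path obeying the strong law, the sums with `k ≥ k₀` stay above `-c * k ≥ -c * m`; the
  -- finitely many earlier ones have a lower bound `B`, which `-c * m` eventually undercuts.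
  obtain ⟨k₀, hk₀⟩ := eventually_atTop.1 (hω.eventually_const_lt (neg_lt_neg hc))
  obtain ⟨B, hB⟩ := ((Finset.range k₀).image fun k => pathSum Y k ω).bddBelow
  have hlarge : ∀ᶠ m : ℕ in atTop, -B ≤ c * m :=
    (tendsto_natCast_atTop_atTop.const_mul_atTop hcpos).eventually_ge_atTop _
  filter_upwards [hlarge] with m hm
  simp only [Set.mem_empty_iff_false, iff_false, not_exists, not_and, not_lt]
  intro k hk
  rcases lt_or_ge k k₀ with hlt | hge
  · have : B ≤ pathSum Y k ω := hB (by simpa using ⟨k, hlt, rfl⟩)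
    linarith
  · have h1 : -c < pathSum Y k ω / k := hk₀ k hge
    rcases Nat.eq_zero_or_pos k with rfl | hkpos
    · simp only [pathSum, Finset.range_zero, Finset.sum_empty, Left.neg_nonpos_iff]
      positivity
    · have hk' : (0 : ℝ) < k := by exact_mod_cast hkpos
      rw [lt_div_iff₀ hk'] at h1
      have : c * k ≤ c * m := by gcongr
      linarith

end TiltedPair

lemma IsTest.measurableSet_le {T : (ℕ → S) → ℕ∞} {D : (ℕ → S) → Fin 2} (hT : IsTest T D) (m : ℕ) :
    MeasurableSet {ω | T ω ≤ m} := by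
  have : {ω | T ω ≤ m} = ⋃ n ≤ m, {ω | T ω = n} := by
    ext ω
    simp only [Set.mem_ofPred_eq, Set.mem_iUnion, exists_prop]
    constructor
    · intro h
      obtain ⟨n, hn⟩ := ENat.ne_top_iff_exists.1 (ne_top_of_le_ne_top (ENat.natCast_ne_top m) h)
      rw [← hn] at h
      exact ⟨n, by exact_mod_cast h, hn.symm⟩
    · rintro ⟨n, hn, h⟩
      rw [h]
      exact_mod_cast hn
  rw [this]
  exact .iUnion fun n => .iUnion fun _ => obsSigma_le n _ (hT.measurableSet_stop n)

namespace TiltedPair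

variable {μ η : Measure S} [IsProbabilityMeasure μ] [IsProbabilityMeasure η] {Y : S → ℝ} {I : ℝ}

/-- A test with small error probabilities is unlikely to stop early. -/
lemma measure_stop_le (h : TiltedPair μ η Y I) {T : (ℕ → S) → ℕ∞} {D : (ℕ → S) → Fin 2}
    (hT : IsTest T D) {d d' : Fin 2} (hdd : d ≠ d') (m : ℕ) (c : ℝ) :
    Measure.infinitePi (fun _ : ℕ => μ) {ω | T ω ≤ m}
      ≤ Measure.infinitePi (fun _ : ℕ => μ) {ω | D ω = d}
        + Measure.infinitePi (fun _ : ℕ => μ) {ω | ∃ k ≤ m, pathSum Y k ω < -c}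
        + ENNReal.ofReal (Real.exp c) * Measure.infinitePi (fun _ : ℕ => η) {ω | D ω = d'} := by
  set P := Measure.infinitePi fun _ : ℕ => μ
  set Q := Measure.infinitePi fun _ : ℕ => η
  -- On `G n` the density of `Q` with respect to `P` is at least `exp (-c)`, so `P` exceeds `Q`
  -- there by a factor of at most `exp c`.
  let G : ℕ → Set (ℕ → S) := fun n => {ω | T ω = n ∧ D ω = d'} ∩ {ω | -c ≤ pathSum Y n ω}
  have hG : ∀ n, MeasurableSet[obsSigma S n] (G n) := fun n =>
    (hT.measurableSet_stop_decision n d').inter (@measurableSet_le _ _ _ _ _ (_) _ _ _ _ _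
      measurable_const (measurable_obsSigma_pathSum h.measurable le_rfl))
  have hPG : ∀ n, P (G n) ≤ ENNReal.ofReal (Real.exp c) * Q (G n) := by
    intro n
    have hmeas := obsSigma_le n _ (hG n)
    have hlow : ENNReal.ofReal (Real.exp (-c)) * P (G n) ≤ Q (G n) := by
      rw [h.infinitePi_apply (hG n), ← setLIntegral_const]
      refine setLIntegral_mono' hmeas fun ω hω => ?_
      exact ENNReal.ofReal_le_ofReal (Real.exp_le_exp.2 hω.2)
    calc P (G n) = ENNReal.ofReal (Real.exp c) * (ENNReal.ofReal (Real.exp (-c)) * P (G n)) := by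
          rw [← mul_assoc, ← ENNReal.ofReal_mul (Real.exp_pos _).le, ← Real.exp_add]
          simp
      _ ≤ _ := by gcongr
  have hcover : {ω | T ω ≤ m} ⊆ {ω | D ω = d} ∪ {ω | ∃ k ≤ m, pathSum Y k ω < -c}
      ∪ ⋃ n ∈ Finset.range (m + 1), G n := by
    intro ω hω
    obtain ⟨n, hn⟩ := ENat.ne_top_iff_exists.1 (ne_top_of_le_ne_top (ENat.natCast_ne_top m) hω)
    have hnm : n ≤ m := by
      have : T ω ≤ m := hω
      rw [← hn] at this
      exact_mod_cast this
    by_cases hD : D ω = d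
    · exact Or.inl (Or.inl hD)
    by_cases hE : pathSum Y n ω < -c
    · exact Or.inl (Or.inr ⟨n, hnm, hE⟩)
    · refine Or.inr ?_
      simp only [Set.mem_iUnion]
      exact ⟨n, by simp; omega, ⟨hn.symm, by omega⟩, not_lt.1 hE⟩
  refine (measure_mono hcover).trans ((measure_union_le _ _).trans ?_)
  refine add_le_add (measure_union_le _ _) ?_
  calc P (⋃ n ∈ Finset.range (m + 1), G n) ≤ ∑ n ∈ Finset.range (m + 1), P (G n) :=
        measure_biUnion_finset_le _ _
    _ ≤ ∑ n ∈ Finset.range (m + 1), ENNReal.ofReal (Real.exp c) * Q (G n) :=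
        Finset.sum_le_sum fun n _ => hPG n
    -- The sets are disjoint because `T` takes one value on each path, so no factor `m + 1` is lost.
    _ = ENNReal.ofReal (Real.exp c) * Q (⋃ n ∈ Finset.range (m + 1), G n) := by
        rw [← Finset.mul_sum, measure_biUnion_finset ?_ fun n _ => obsSigma_le n _ (hG n)]
        intro i _ j _ hij
        refine Set.disjoint_left.2 fun ω hi hj => hij ?_
        have : (i : ℕ∞) = j := hi.1.1.symm.trans hj.1.1
        exact_mod_cast this
    _ ≤ _ := by
        gcongr
        simp only [Set.iUnion_subset_iff]
        exact fun n _ ω hω => hω.1.2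

/-- The asymptotic lower bound on the expected sample size of a test. -/
lemma exists_le_lintegral_of_isTest (h : TiltedPair μ η Y I) {ε : ℝ} (hε : 0 < ε) (hε1 : ε < 1) :
    ∃ δ ∈ Set.Ioo (0 : ℝ) 1, ∀ a ∈ Set.Ioo 0 δ, ∀ b ∈ Set.Ioo 0 δ, ∀ (T : (ℕ → S) → ℕ∞)
      (D : (ℕ → S) → Fin 2) (d d' : Fin 2), IsTest T D → d ≠ d' →
      (Measure.infinitePi fun _ : ℕ => μ).real {ω | D ω = d} ≤ a →
      (Measure.infinitePi fun _ : ℕ => η).real {ω | D ω = d'} ≤ b →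
      ENNReal.ofReal ((1 - ε) * (|Real.log b| / I))
        ≤ ∫⁻ ω, (T ω : ℝ≥0∞) ∂(Measure.infinitePi fun _ : ℕ => μ) := by
  set P := Measure.infinitePi fun _ : ℕ => μ
  have hI := h.pos
  -- One factor `1 - e` is lost in the time `m` and one in the probability of exceeding it, and `(1
  -- - e) ^ 2 ≥ 1 - ε`.
  set e := ε / 2 with he
  have he0 : 0 < e := by positivity
  have he1 : e < 1 / 2 := by linarith
  have hmax := (ENNReal.tendsto_toReal ENNReal.zero_ne_top).comp
    (h.tendsto_measure_exists_pathSum_lt (c := (1 + e) * I) (by nlinarith))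
  have hL : Tendsto (fun b : ℝ => |Real.log b|) (𝓝[>] 0) atTop :=
    tendsto_abs_atBot_atTop.comp Real.tendsto_log_nhdsGT_zero
  have hm : Tendsto (fun b : ℝ => ⌊(1 - e) * |Real.log b| / I⌋₊) (𝓝[>] 0) atTop :=
    tendsto_nat_floor_atTop.comp
      ((hL.const_mul_atTop (by linarith : 0 < 1 - e)).atTop_div_const hI)
  have hexp : Tendsto (fun b : ℝ => Real.exp (-(e ^ 2 * |Real.log b|))) (𝓝[>] 0) (𝓝 0) :=
    Real.tendsto_exp_neg_atTop_nhds_zero.comp (hL.const_mul_atTop (by positivity))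
  have e3 : (0 : ℝ) < e / 3 := by positivity
  have hev := ((hmax.comp hm).eventually_lt_const (u := e / 3) (by simpa using e3)).and
    (hexp.eventually_lt_const e3)
  obtain ⟨δ, hδ, hsub⟩ := mem_nhdsGT_iff_exists_Ioo_subset.1 hev
  refine ⟨min δ (min (e / 3) (1 / 2)), ⟨lt_min hδ (lt_min e3 (by norm_num)),
    (min_le_right _ _).trans_lt ((min_le_right _ _).trans_lt (by norm_num))⟩, ?_⟩
  intro a ha b hb T D d d' hT hdd hPa hQb
  obtain ⟨h1, h2⟩ := hsub ⟨hb.1, hb.2.trans_le (min_le_left _ _)⟩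
  have hae : a < e / 3 := ha.2.trans_le ((min_le_right _ _).trans (min_le_left _ _))
  have hb1 : b < 1 := hb.2.trans_le ((min_le_right _ _).trans
    ((min_le_right _ _).trans (by norm_num)))
  set L := |Real.log b| with hLdef
  have hLpos : 0 < L := abs_pos.2 (Real.log_neg hb.1 hb1).ne
  have hblog : b = Real.exp (-L) := by
    rw [hLdef, abs_of_neg (Real.log_neg hb.1 hb1), neg_neg, Real.exp_log hb.1]
  set m := ⌊(1 - e) * L / I⌋₊ with hmdef
  have hmle : (m : ℝ) ≤ (1 - e) * L / I :=
    Nat.floor_le (div_nonneg (mul_nonneg (by linarith) hLpos.le) hI.le)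
  have hmgt : (1 - e) * L / I < m + 1 := Nat.lt_floor_add_one _
  have hbound := h.measure_stop_le hT hdd m ((1 + e) * I * m)
  have hPT : P.real {ω | T ω ≤ m} ≤ e := by
    have := ENNReal.toReal_mono (by finiteness) hbound
    rw [ENNReal.toReal_add (by finiteness) (by finiteness),
      ENNReal.toReal_add (by finiteness) (by finiteness), ENNReal.toReal_mul,
      ENNReal.toReal_ofReal (Real.exp_pos _).le] at this
    -- Since `I * m ≤ (1 - e) * L`, the exponent is at most `(1 - e ^ 2) * L - L = -e ^ 2 * L`.
    have h3 : Real.exp ((1 + e) * I * m)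
        * (Measure.infinitePi fun _ : ℕ => η).real {ω | D ω = d'} ≤ e / 3 := by
      calc _ ≤ Real.exp ((1 + e) * I * m) * Real.exp (-L) := by
            gcongr
            exact hQb.trans_eq hblog
        _ = Real.exp ((1 + e) * I * m - L) := by rw [← Real.exp_add]; ring_nf
        _ ≤ Real.exp (-(e ^ 2 * L)) := by
            refine Real.exp_le_exp.2 ?_
            rw [le_div_iff₀ hI] at hmle
            nlinarith
        _ ≤ e / 3 := h2.le
    have h1' : (P {ω | ∃ k ≤ m, pathSum Y k ω < -((1 + e) * I * m)}).toReal ≤ e / 3 := h1.le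
    simp only [measureReal_def] at hPa h3 ⊢
    linarith
  have hmeas := hT.measurableSet_le m
  have hcompl : 1 - e ≤ P.real {ω | T ω ≤ m}ᶜ := by
    rw [probReal_compl_eq_one_sub hmeas]
    linarith
  -- Markov's inequality at `m + 1`: `T` is integer-valued, so the rounding in `m` costs nothing.
  calc ENNReal.ofReal ((1 - ε) * (L / I))
      ≤ ENNReal.ofReal ((m + 1) * (1 - e)) := by
        refine ENNReal.ofReal_le_ofReal ?_
        have hLI : 0 < L / I := by positivity
        rw [mul_div_assoc] at hmgt
        have : (1 - e) * (L / I) * (1 - e) ≤ (m + 1) * (1 - e) :=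
          mul_le_mul_of_nonneg_right hmgt.le (by linarith)
        nlinarith [sq_nonneg e]
    _ ≤ ENNReal.ofReal (m + 1) * P {ω | T ω ≤ m}ᶜ := by
        rw [ENNReal.ofReal_mul (by positivity)]
        gcongr
        rw [← ofReal_measureReal]
        exact ENNReal.ofReal_le_ofReal hcompl
    _ = ∫⁻ ω, ({ω | T ω ≤ m}ᶜ).indicator (fun _ => ENNReal.ofReal (m + 1)) ω ∂P := by
        rw [lintegral_indicator_const hmeas.compl]
    _ ≤ _ := by
        refine lintegral_mono fun ω => ?_
        by_cases hω : ω ∈ {ω | T ω ≤ m}ᶜ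
        swap
        · rw [Set.indicator_of_notMem hω]
          exact zero_le
        rw [Set.indicator_of_mem hω]
        have hω' : ((m : ℕ∞) + 1) ≤ T ω := Order.add_one_le_of_lt (not_le.1 hω)
        have := ENat.toENNReal_le.2 hω'
        refine le_trans (le_of_eq ?_) this
        rw [show ((m : ℝ) + 1) = ((m + 1 : ℕ) : ℝ) by push_cast; rfl, ENNReal.ofReal_natCast]
        push_cast
        rfl

end TiltedPair

end LowerBound

/-! ### Likelihood ratios of densities, and the fixed-sample-size test. -/

section FixedSample

variable {S : Type*} [MeasurableSpace S] {ν : Measure S}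

lemma ProbDensity.ae_eq_zero_of_absolutelyContinuous {g h : ProbDensity ν} (hgh : g.law ≪ h.law) :
    ∀ᵐ x ∂ν, h.toFun x = 0 → g.toFun x = 0 := by
  have hmg := g.measurable_toFun
  have hmh := h.measurable_toFun
  have hA : MeasurableSet {x | h.toFun x = 0} := hmh (measurableSet_singleton 0)
  have h0 : h.law {x | h.toFun x = 0} = 0 := by
    rw [ProbDensity.law, withDensity_apply _ hA, setLIntegral_congr_fun (g := 0) hA]
    · simp
    · intro x hx
      have : h.toFun x = 0 := hx
      simp [this]
  have h1 := hgh h0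
  rw [ProbDensity.law, withDensity_apply_eq_zero (by fun_prop)] at h1
  filter_upwards [measure_eq_zero_iff_ae_notMem.1 h1] with x hx hhx
  by_contra hne
  refine hx ⟨?_, hhx⟩
  have : 0 < g.toFun x := lt_of_le_of_ne (g.nonneg x) (Ne.symm hne)
  simpa using this

/-- Mutual absolute continuity makes the two densities vanish together outside a `ν`-null set. Where
they vanish, the default value `exp (log (0 / 0)) = 1` is multiplied by `0`; elsewhere the
exponential undoes the logarithm. -/
lemma ProbDensity.law_eq_withDensity_exp {g h : ProbDensity ν} (hgh : g.law ≪ h.law)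
    (hhg : h.law ≪ g.law) :
    h.law = g.law.withDensity
      fun x => ENNReal.ofReal (Real.exp (Real.log (h.toFun x / g.toFun x))) := by
  have hmg := g.measurable_toFun
  have hmh := h.measurable_toFun
  rw [ProbDensity.law, ProbDensity.law, ← withDensity_mul _ (by fun_prop) (by fun_prop)]
  refine withDensity_congr_ae ?_
  filter_upwards [ProbDensity.ae_eq_zero_of_absolutelyContinuous hgh,
    ProbDensity.ae_eq_zero_of_absolutelyContinuous hhg] with x h1 h2
  simp only [Pi.mul_apply]
  rw [← ENNReal.ofReal_mul (g.nonneg x)]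
  rcases (g.nonneg x).eq_or_lt with hg | hg
  · simp [h2 hg.symm, ← hg]
  · have hh : 0 < h.toFun x :=
      lt_of_le_of_ne (h.nonneg x) fun h0 => hg.ne' (h1 h0.symm)
    rw [Real.exp_log (div_pos hh hg), mul_div_cancel₀ _ hg.ne']

/-- Finiteness of the first divergence gives integrability and one absolute continuity; finiteness
of the second gives the reverse one. For laws of equal mass the divergence is the plain integral of
the log-likelihood ratio. -/
lemma ProbDensity.tiltedPair {g h : ProbDensity ν}
    (hgh : InformationTheory.klDiv g.law h.law ∈ Set.Ioo 0 ∞)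
    (hhg : InformationTheory.klDiv h.law g.law ≠ ∞) :
    TiltedPair g.law h.law (fun x => Real.log (h.toFun x / g.toFun x))
      (InformationTheory.klDiv g.law h.law).toReal := by
  have hmg := g.measurable_toFun
  have hmh := h.measurable_toFun
  obtain ⟨hac, hint⟩ := InformationTheory.klDiv_ne_top_iff.1 hgh.2.ne
  obtain ⟨hac', -⟩ := InformationTheory.klDiv_ne_top_iff.1 hhg
  have hllr : llr g.law h.law =ᵐ[g.law] fun x => - Real.log (h.toFun x / g.toFun x) := by
    have h1 := Measure.rnDeriv_withDensity h.law
      (f := fun x => ENNReal.ofReal (Real.exp (Real.log (g.toFun x / h.toFun x)))) (by fun_prop)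
    rw [← ProbDensity.law_eq_withDensity_exp hac' hac] at h1
    filter_upwards [hac.ae_le h1] with x hx
    rw [llr, hx, ENNReal.toReal_ofReal (Real.exp_pos _).le, Real.log_exp, ← Real.log_inv, inv_div]
  refine ⟨by fun_prop, ?_, ?_, ENNReal.toReal_pos hgh.1.ne' hgh.2.ne,
    ProbDensity.law_eq_withDensity_exp hac hac'⟩
  · simpa using (hint.congr hllr).neg
  · rw [InformationTheory.toReal_klDiv_of_measure_eq hac (by simp), integral_congr_ae hllr,
      integral_neg, neg_neg]

/-- The log-likelihood ratio of a single observation. -/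
noncomputable def stepLLR (f : Fin 2 → ProbDensity ν) (x : S) : ℝ :=
  Real.log ((f 1).toFun x / (f 0).toFun x)

lemma logLR_eq_pathSum (f : Fin 2 → ProbDensity ν) (n : ℕ) : logLR f n = pathSum (stepLLR f) n :=
  rfl

/-- Both laws are exponential tilts of each other, with drifts `-I0` under the null and `I1` under
the alternative. -/
structure TiltedPairs (f : Fin 2 → ProbDensity ν) (I0 I1 : ℝ) : Prop where
  null : TiltedPair (f 0).law (f 1).law (stepLLR f) I0
  alt : TiltedPair (f 1).law (f 0).law (fun x => - stepLLR f x) I1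

lemma tiltedPairs_of_klDiv {f : Fin 2 → ProbDensity ν}
    (hI0 : InformationTheory.klDiv (f 0).law (f 1).law ∈ Set.Ioo 0 ∞)
    (hI1 : InformationTheory.klDiv (f 1).law (f 0).law ∈ Set.Ioo 0 ∞) :
    TiltedPairs f (InformationTheory.klDiv (f 0).law (f 1).law).toReal
      (InformationTheory.klDiv (f 1).law (f 0).law).toReal where
  null := ProbDensity.tiltedPair hI0 hI1.2.ne
  alt := by
    have h := ProbDensity.tiltedPair hI1 hI0.2.ne
    have heq : (fun x => - stepLLR f x)
        = fun x => Real.log ((f 0).toFun x / (f 1).toFun x) := by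
      ext x
      rw [stepLLR, ← Real.log_inv, inv_div]
    rwa [heq]

instance isProbabilityMeasure_pathLaw (f : Fin 2 → ProbDensity ν) (i : Fin 2) :
    IsProbabilityMeasure (pathLaw f i) := by
  unfold pathLaw
  infer_instance

lemma measurable_stepLLR (f : Fin 2 → ProbDensity ν) : Measurable (stepLLR f) := by
  have h0 := (f 0).measurable_toFun
  have h1 := (f 1).measurable_toFun
  unfold stepLLR
  fun_prop

lemma measurable_avgLLR (f : Fin 2 → ProbDensity ν) (n : ℕ) : Measurable (avgLLR f n) := by
  have := measurable_pathSum (measurable_stepLLR f) n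
  unfold avgLLR
  rw [logLR_eq_pathSum]
  fun_prop

lemma measurable_obsSigma_avgLLR (f : Fin 2 → ProbDensity ν) {m n : ℕ} (hmn : m ≤ n) :
    Measurable[obsSigma S n] (avgLLR f m) := by
  have := measurable_obsSigma_pathSum (measurable_stepLLR f) hmn
  exact Measurable.div_const this _

lemma setOf_lt_avgLLR_subset (f : Fin 2 → ProbDensity ν) {n : ℕ} (hn : 1 ≤ n) (c : ℝ) :
    {ω | c < avgLLR f n ω} ⊆ {ω | n * c ≤ pathSum (stepLLR f) n ω} := by
  intro ω (hω : c < avgLLR f n ω)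
  have hn' : (0 : ℝ) < n := by exact_mod_cast hn
  rw [avgLLR, lt_div_iff₀ hn', mul_comm] at hω
  exact hω.le

lemma setOf_avgLLR_le_subset (f : Fin 2 → ProbDensity ν) {n : ℕ} (hn : 1 ≤ n) (c : ℝ) :
    {ω | avgLLR f n ω ≤ c} ⊆ {ω | n * (-c) ≤ pathSum (fun x => - stepLLR f x) n ω} := by
  intro ω (hω : avgLLR f n ω ≤ c)
  have hn' : (0 : ℝ) < n := by exact_mod_cast hn
  rw [avgLLR, div_le_iff₀ hn', mul_comm] at hω
  change _ ≤ pathSum _ _ _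
  rw [pathSum_neg, ← logLR_eq_pathSum]
  linarith

lemma fixedTestControls_of_tail_le {f : Fin 2 → ProbDensity ν} {a b c : ℝ} {n : ℕ} (hn : 1 ≤ n)
    (h0 : (pathLaw f 0).real {ω | n * c ≤ pathSum (stepLLR f) n ω} ≤ a)
    (h1 : (pathLaw f 1).real {ω | n * (-c) ≤ pathSum (fun x => - stepLLR f x) n ω} ≤ b) :
    FixedTestControls f a b n c :=
  ⟨(measureReal_mono (setOf_lt_avgLLR_subset f hn c)).trans h0,
    (measureReal_mono (setOf_avgLLR_le_subset f hn c)).trans h1⟩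

lemma nStar_le {f : Fin 2 → ProbDensity ν} {a b c : ℝ} {n : ℕ} (hn : 1 ≤ n)
    (h : FixedTestControls f a b n c) : nStar f a b ≤ n :=
  Nat.sInf_le ⟨hn, c, h⟩

lemma FixedTestControls.mono {f : Fin 2 → ProbDensity ν} {a b a' b' c : ℝ} {n : ℕ}
    (h : FixedTestControls f a b n c) (ha : a ≤ a') (hb : b ≤ b') :
    FixedTestControls f a' b' n c :=
  ⟨h.1.trans ha, h.2.trans hb⟩

/-- The levels at `j = 0` are `(x / 4) ^ 0 = 1`; this puts `0` among the admissible numbers of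
additional stages. -/
lemma nStar_one (f : Fin 2 → ProbDensity ν) : nStar f 1 1 ≤ 1 :=
  nStar_le (c := 0) le_rfl ⟨measureReal_le_one, measureReal_le_one⟩

namespace TiltedPairs

variable {f : Fin 2 → ProbDensity ν} {I0 I1 : ℝ}

/-- The test with threshold zero has error probabilities that decay exponentially. -/
lemma exists_fixedTestControls_exp (h : TiltedPairs f I0 I1) :
    ∃ r > 0, ∀ n : ℕ, 1 ≤ n →
      FixedTestControls f (Real.exp (-(r * n))) (Real.exp (-(r * n))) n 0 := by
  -- Zero lies strictly between the drifts `-I0` and `I1`.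
  obtain ⟨r0, hr0, h0⟩ := h.null.exists_tail_le_exp (t := 0) (by linarith [h.null.pos])
  obtain ⟨r1, hr1, h1⟩ := h.alt.exists_tail_le_exp (t := 0) (by linarith [h.alt.pos])
  refine ⟨min r0 r1, lt_min hr0 hr1, fun n hn => fixedTestControls_of_tail_le hn ?_ ?_⟩
  · refine (h0 n).trans (Real.exp_le_exp.2 ?_)
    gcongr
    exact min_le_left _ _
  · rw [neg_zero]
    refine (h1 n).trans (Real.exp_le_exp.2 ?_)
    gcongr
    exact min_le_right _ _

/-- The sample size of the fixed-sample-size test with equal error probabilities `x` is at most of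
the order of `|log x|`. -/
lemma exists_nStar_le_log (h : TiltedPairs f I0 I1) :
    ∃ C > 0, ∀ x ∈ Set.Ioc (0 : ℝ) 1, ∀ a b : ℝ, x ≤ a → x ≤ b →
      (nStar f a b : ℝ) ≤ C * |Real.log x| + 1 ∧ ∃ c n, 1 ≤ n ∧ FixedTestControls f a b n c := by
  obtain ⟨r, hr, hctrl⟩ := h.exists_fixedTestControls_exp
  refine ⟨r⁻¹, inv_pos.2 hr, fun x hx a b hxa hxb => ?_⟩
  have hlog : |Real.log x| = -Real.log x := abs_of_nonpos (Real.log_nonpos hx.1.le hx.2)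
  set n := ⌊r⁻¹ * |Real.log x|⌋₊ + 1 with hn
  have hnx : Real.exp (-(r * n)) ≤ x := by
    rw [← Real.le_log_iff_exp_le hx.1]
    have : r⁻¹ * |Real.log x| ≤ n := by
      rw [hn]
      push_cast
      exact (Nat.lt_floor_add_one _).le
    rw [inv_mul_le_iff₀ hr] at this
    linarith
  have hc := (hctrl n (by omega)).mono (hnx.trans hxa) (hnx.trans hxb)
  refine ⟨?_, 0, n, by omega, hc⟩
  have h1 : (nStar f a b : ℝ) ≤ n := by exact_mod_cast nStar_le (by omega) hc
  have h2 : (n : ℝ) ≤ r⁻¹ * |Real.log x| + 1 := by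
    rw [hn]
    push_cast
    gcongr
    exact Nat.floor_le (by positivity)
  linarith

/-- Keeps the infimum in `nStar` from being the default value `0`. -/
lemma nonempty_sampleSizes (h : TiltedPairs f I0 I1) {a b : ℝ} (ha : 0 < a) (hb : 0 < b) :
    {n : ℕ | 1 ≤ n ∧ ∃ c : ℝ, FixedTestControls f a b n c}.Nonempty := by
  obtain ⟨C, -, hC⟩ := h.exists_nStar_le_log
  obtain ⟨-, c, n, hn, hc⟩ := hC (min (min a b) 1) ⟨by positivity, min_le_right _ _⟩ a b
    ((min_le_left _ _).trans (min_le_left _ _)) ((min_le_left _ _).trans (min_le_right _ _))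
  exact ⟨n, hn, c, hc⟩

lemma nStar_spec (h : TiltedPairs f I0 I1) {a b : ℝ} (ha : 0 < a) (hb : 0 < b) :
    1 ≤ nStar f a b ∧ ∃ c : ℝ, FixedTestControls f a b (nStar f a b) c :=
  Nat.sInf_mem (h.nonempty_sampleSizes ha hb)

lemma nStar_anti (h : TiltedPairs f I0 I1) {a b a' b' : ℝ} (ha : 0 < a) (hb : 0 < b)
    (haa : a ≤ a') (hbb : b ≤ b') : nStar f a' b' ≤ nStar f a b := by
  obtain ⟨h1, c, hc⟩ := h.nStar_spec ha hb
  exact nStar_le h1 (hc.mono haa hbb)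

end TiltedPairs

/-- For `a < 1`, the thresholds for which the type-I error probability is at most `a` form a closed
half-line. -/
lemma exists_threshold_iff (f : Fin 2 → ProbDensity ν) {a c₁ : ℝ} (n : ℕ) (ha : a < 1)
    (hc₁ : (pathLaw f 0).real {ω | c₁ < avgLLR f n ω} ≤ a) :
    ∃ c₀, ∀ c, (pathLaw f 0).real {ω | c < avgLLR f n ω} ≤ a ↔ c₀ ≤ c := by
  have hX := measurable_avgLLR f n
  have : IsProbabilityMeasure ((pathLaw f 0).map (avgLLR f n)) :=
    Measure.isProbabilityMeasure_map hX.aemeasurable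
  let F := cdf ((pathLaw f 0).map (avgLLR f n))
  have hF : ∀ c, (pathLaw f 0).real {ω | c < avgLLR f n ω} ≤ a ↔ 1 - a ≤ F c := by
    intro c
    have h1 : F c = (pathLaw f 0).real {ω | avgLLR f n ω ≤ c} := by
      rw [cdf_eq_real, map_measureReal_apply hX measurableSet_Iic]
      rfl
    have h2 : {ω | c < avgLLR f n ω} = {ω | avgLLR f n ω ≤ c}ᶜ := by
      ext ω
      simp
    rw [h1, h2, probReal_compl_eq_one_sub (measurableSet_le hX measurable_const)]
    constructor <;> intro h <;> linarith
  have hne : {c | 1 - a ≤ F c}.Nonempty := ⟨c₁, (hF c₁).1 hc₁⟩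
  -- Here `a < 1` is essential: the distribution function must reach the positive level `1 - a`.
  have hbdd : BddBelow {c | 1 - a ≤ F c} := by
    obtain ⟨m, hm⟩ := ((tendsto_cdf_atBot _).eventually_lt_const
      (show (0 : ℝ) < 1 - a by linarith)).exists
    exact ⟨m, fun c hc => le_of_not_gt fun hcm => (hc.trans (monotone_cdf _ hcm.le)).not_gt hm⟩
  refine ⟨sInf {c | 1 - a ≤ F c}, fun c => (hF c).trans ⟨fun hc => csInf_le hbdd hc, fun hc => ?_⟩⟩
  -- Right continuity of the distribution function makes the infimum attained.
  have hright : Tendsto F (𝓝[>] sInf {c | 1 - a ≤ F c}) (𝓝 (F (sInf {c | 1 - a ≤ F c}))) :=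
    (F.right_continuous _).mono_left (nhdsWithin_mono _ Set.Ioi_subset_Ici_self)
  have hev : ∀ᶠ c in 𝓝[>] sInf {c | 1 - a ≤ F c}, 1 - a ≤ F c := by
    filter_upwards [self_mem_nhdsWithin] with c hc
    obtain ⟨c', hc', hlt⟩ := exists_lt_of_csInf_lt hne hc
    exact hc'.trans (monotone_cdf _ hlt.le)
  exact (ge_of_tendsto hright hev).trans (monotone_cdf _ hc)

namespace TiltedPairs

variable {f : Fin 2 → ProbDensity ν} {I0 I1 : ℝ}

/-- The threshold `c*(a, b)` is attained, and it is the least threshold for which the type-I error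
probability of the test of size `n*(a, b)` is at most `a`. -/
lemma cStar_spec (h : TiltedPairs f I0 I1) {a b : ℝ} (ha : 0 < a) (ha1 : a < 1) (hb : 0 < b) :
    FixedTestControls f a b (nStar f a b) (cStar f a b) ∧
    ∀ c, (pathLaw f 0).real {ω | c < avgLLR f (nStar f a b) ω} ≤ a ↔ cStar f a b ≤ c := by
  obtain ⟨-, c₁, hc₁⟩ := h.nStar_spec ha hb
  obtain ⟨c₀, hc₀⟩ := exists_threshold_iff f _ ha1 hc₁.1
  -- Lowering the threshold to the least one that the type-I constraint allows can only reduce the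
  -- type-II error.
  have hmem : FixedTestControls f a b (nStar f a b) c₀ := by
    refine ⟨(hc₀ c₀).2 le_rfl, (measureReal_mono fun ω hω => ?_).trans hc₁.2⟩
    exact le_trans (show avgLLR f _ ω ≤ c₀ from hω) ((hc₀ c₁).1 hc₁.1)
  have hleast : IsLeast {c : ℝ | FixedTestControls f a b (nStar f a b) c} c₀ :=
    ⟨hmem, fun c hc => (hc₀ c).1 hc.1⟩
  have heq : cStar f a b = c₀ := hleast.csInf_eq
  rw [heq]
  exact ⟨hmem, hc₀⟩

end TiltedPairs

namespace TiltedPair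

variable {μ η : Measure S} [IsProbabilityMeasure μ] [IsProbabilityMeasure η] {Y : S → ℝ} {I : ℝ}

/-- Sample size and threshold of a fixed-sample-size test for which the error probability under `η`
is `b` and that under `μ` is much larger. -/
lemma exists_tails_le (h : TiltedPair μ η Y I) (h' : ∃ J, TiltedPair η μ (fun x => - Y x) J)
    {ε : ℝ} (hε : 0 < ε) :
    ∃ κ > 0, ∀ b ∈ Set.Ioo (0 : ℝ) 1, ∀ g ∈ Set.Ioo (0 : ℝ) 1, |Real.log g| ≤ κ * |Real.log b| →
      ∃ (n : ℕ) (t : ℝ), 1 ≤ n ∧ (n : ℝ) ≤ (1 + ε) * (|Real.log b| / I) + 1 ∧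
        (Measure.infinitePi fun _ : ℕ => μ).real {ω | n * t ≤ pathSum Y n ω} ≤ g ∧
        (Measure.infinitePi fun _ : ℕ => η).real {ω | n * (-t) ≤ pathSum (fun x => - Y x) n ω}
          ≤ b := by
  obtain ⟨J, h'⟩ := h'
  have hI := h.pos
  -- The threshold sits just above the drift. Under `μ` some exponential rate `r > 0` remains; under
  -- `η` the exponent is `I / (1 + ε)` per observation, which forces the size `(1 + ε) * |log b| /
  -- I`. The constant `κ` is what `r` yields at that size.
  have ht : -I < -(I / (1 + ε)) := by
    rw [neg_lt_neg_iff]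
    exact div_lt_self hI (by linarith)
  obtain ⟨r, hr, htail⟩ := h.exists_tail_le_exp ht
  refine ⟨r * (1 + ε) / I, by positivity, fun b hb g hg hgb => ?_⟩
  have hlogb : |Real.log b| = -Real.log b := abs_of_neg (Real.log_neg hb.1 hb.2)
  have hlogg : |Real.log g| = -Real.log g := abs_of_neg (Real.log_neg hg.1 hg.2)
  set x := (1 + ε) * (|Real.log b| / I) with hx
  have hx0 : 0 ≤ x := by positivity
  have hn : x ≤ (⌊x⌋₊ + 1 : ℕ) := by
    push_cast
    exact (Nat.lt_floor_add_one _).le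
  refine ⟨⌊x⌋₊ + 1, -(I / (1 + ε)), by omega, ?_, (htail _).trans ?_,
    (h'.tail_le_exp _ _).trans ?_⟩
  · push_cast
    gcongr
    exact Nat.floor_le hx0
  · rw [← Real.le_log_iff_exp_le hg.1]
    have h1 : r * x ≤ r * (⌊x⌋₊ + 1 : ℕ) := by gcongr
    have h2 : r * x = r * (1 + ε) / I * |Real.log b| := by rw [hx]; ring
    linarith
  · rw [← Real.le_log_iff_exp_le hb.1, neg_neg]
    have h1 : x * (I / (1 + ε)) ≤ (⌊x⌋₊ + 1 : ℕ) * (I / (1 + ε)) := by gcongr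
    have h2 : x * (I / (1 + ε)) = |Real.log b| := by
      rw [hx]
      field_simp
    linarith

end TiltedPair

namespace TiltedPairs

variable {f : Fin 2 → ProbDensity ν} {I0 I1 : ℝ}

lemma exists_nStar_le_null (h : TiltedPairs f I0 I1) {ε : ℝ} (hε : 0 < ε) :
    ∃ κ > 0, ∀ b ∈ Set.Ioo (0 : ℝ) 1, ∀ g ∈ Set.Ioo (0 : ℝ) 1, |Real.log g| ≤ κ * |Real.log b| →
      (nStar f g b : ℝ) ≤ (1 + ε) * (|Real.log b| / I0) + 1 := by
  obtain ⟨κ, hκ, H⟩ := h.null.exists_tails_le ⟨I1, h.alt⟩ hε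
  refine ⟨κ, hκ, fun b hb g hg hgb => ?_⟩
  obtain ⟨n, t, hn, hle, h0, h1⟩ := H b hb g hg hgb
  exact le_trans (by exact_mod_cast nStar_le hn (fixedTestControls_of_tail_le hn h0 h1)) hle

lemma exists_nStar_le_alt (h : TiltedPairs f I0 I1) {ε : ℝ} (hε : 0 < ε) :
    ∃ κ > 0, ∀ a ∈ Set.Ioo (0 : ℝ) 1, ∀ g ∈ Set.Ioo (0 : ℝ) 1, |Real.log g| ≤ κ * |Real.log a| →
      (nStar f a g : ℝ) ≤ (1 + ε) * (|Real.log a| / I1) + 1 := by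
  obtain ⟨κ, hκ, H⟩ := h.alt.exists_tails_le ⟨I0, by simpa using h.null⟩ hε
  refine ⟨κ, hκ, fun a ha g hg hga => ?_⟩
  obtain ⟨n, t, hn, hle, h0, h1⟩ := H a ha g hg hga
  -- Exchanging the hypotheses negates the sums, hence the threshold.
  have hc : FixedTestControls f a g n (-t) :=
    fixedTestControls_of_tail_le hn (by simp only [neg_neg] at h1; exact h1)
      (by rw [neg_neg]; exact h0)
  exact le_trans (by exact_mod_cast nStar_le hn hc) hle

end TiltedPairs

end FixedSample

/-! ### The multistage test: measurability, admissibility, error control and the bound on its mean.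
-/

section Multistage

variable {S : Type*} [MeasurableSpace S] {ν : Measure S}

namespace GMTParams

variable {p : GMTParams} {f : Fin 2 → ProbDensity ν}

lemma accepts_or_rejects_max (f : Fin 2 → ProbDensity ν) (p : GMTParams) (ω : ℕ → S) :
    p.Accepts f ω p.N ∨ p.Rejects f ω p.N :=
  (le_or_gt (avgLLR f p.N ω) p.C).imp (fun h => Or.inr ⟨rfl, h⟩) (fun h => Or.inr ⟨rfl, h⟩)

lemma sampleSize_spec (f : Fin 2 → ProbDensity ν) (p : GMTParams) (ω : ℕ → S) :
    p.Accepts f ω (p.sampleSize f ω) ∨ p.Rejects f ω (p.sampleSize f ω) :=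
  Nat.sInf_mem (s := {n | p.Accepts f ω n ∨ p.Rejects f ω n})
    ⟨p.N, accepts_or_rejects_max f p ω⟩

lemma sampleSize_le_of {ω : ℕ → S} {n : ℕ} (h : p.Accepts f ω n ∨ p.Rejects f ω n) :
    p.sampleSize f ω ≤ n :=
  Nat.sInf_le h

lemma sampleSize_le_max (f : Fin 2 → ProbDensity ν) (p : GMTParams) (ω : ℕ → S) :
    p.sampleSize f ω ≤ p.N :=
  sampleSize_le_of (accepts_or_rejects_max f p ω)

/-- A stage at time `N` or later ignores its own threshold, but the test never outlasts `N` anyway.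
-/
lemma sampleSize_le_of_accept {ω : ℕ → S} {j : ℕ} (hj : j ≤ p.K0)
    (h : avgLLR f (p.N0 j) ω ≤ p.C0 j) : p.sampleSize f ω ≤ p.N0 j := by
  rcases lt_or_ge (p.N0 j) p.N with hlt | hge
  · exact sampleSize_le_of (Or.inl (Or.inl ⟨hlt, j, hj, rfl, h⟩))
  · exact (sampleSize_le_max f p ω).trans hge

lemma sampleSize_le_of_reject {ω : ℕ → S} {j : ℕ} (hj : j ≤ p.K1)
    (h : p.C1 j < avgLLR f (p.N1 j) ω) : p.sampleSize f ω ≤ p.N1 j := by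
  rcases lt_or_ge (p.N1 j) p.N with hlt | hge
  · exact sampleSize_le_of (Or.inr (Or.inl ⟨hlt, j, hj, rfl, h⟩))
  · exact (sampleSize_le_max f p ω).trans hge

lemma sampleSize_eq_iff {ω : ℕ → S} {n : ℕ} :
    p.sampleSize f ω = n ↔ (p.Accepts f ω n ∨ p.Rejects f ω n) ∧
      ∀ m < n, ¬ (p.Accepts f ω m ∨ p.Rejects f ω m) := by
  constructor
  · rintro rfl
    exact ⟨sampleSize_spec f p ω, fun m hm h => (sampleSize_le_of h).not_gt hm⟩
  · rintro ⟨h1, h2⟩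
    refine le_antisymm (sampleSize_le_of h1) (not_lt.1 fun hlt => h2 _ hlt (sampleSize_spec f p ω))

lemma measurableSet_accepts (f : Fin 2 → ProbDensity ν) (p : GMTParams) {m n : ℕ} (hmn : m ≤ n) :
    MeasurableSet[obsSigma S n] {ω | p.Accepts f ω m} := by
  have hle : ∀ c : ℝ, MeasurableSet[obsSigma S n] {ω | avgLLR f m ω ≤ c} := fun c =>
    measurable_obsSigma_avgLLR f hmn measurableSet_Iic
  have heq : {ω | p.Accepts f ω m}
      = (⋃ (_ : m < p.N) (j : ℕ) (_ : j ≤ p.K0) (_ : p.N0 j = m), {ω | avgLLR f m ω ≤ p.C0 j})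
        ∪ ⋃ (_ : m = p.N), {ω | avgLLR f m ω ≤ p.C} := by
    ext ω
    simp only [Accepts, Set.mem_union, Set.mem_iUnion, Set.mem_ofPred_eq, exists_prop]
  rw [heq]
  refine .union (.iUnion fun _ => .iUnion fun j => .iUnion fun _ => .iUnion fun _ => hle _)
    (.iUnion fun _ => hle _)

lemma measurableSet_rejects (f : Fin 2 → ProbDensity ν) (p : GMTParams) {m n : ℕ} (hmn : m ≤ n) :
    MeasurableSet[obsSigma S n] {ω | p.Rejects f ω m} := by
  have hlt : ∀ c : ℝ, MeasurableSet[obsSigma S n] {ω | c < avgLLR f m ω} := fun c =>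
    measurable_obsSigma_avgLLR f hmn measurableSet_Ioi
  have heq : {ω | p.Rejects f ω m}
      = (⋃ (_ : m < p.N) (j : ℕ) (_ : j ≤ p.K1) (_ : p.N1 j = m), {ω | p.C1 j < avgLLR f m ω})
        ∪ ⋃ (_ : m = p.N), {ω | p.C < avgLLR f m ω} := by
    ext ω
    simp only [Rejects, Set.mem_union, Set.mem_iUnion, Set.mem_ofPred_eq, exists_prop]
  rw [heq]
  refine .union (.iUnion fun _ => .iUnion fun j => .iUnion fun _ => .iUnion fun _ => hlt _)
    (.iUnion fun _ => hlt _)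

lemma measurableSet_sampleSize_eq (f : Fin 2 → ProbDensity ν) (p : GMTParams) (n : ℕ) :
    MeasurableSet[obsSigma S n] {ω | p.sampleSize f ω = n} := by
  have heq : {ω | p.sampleSize f ω = n}
      = ({ω | p.Accepts f ω n} ∪ {ω | p.Rejects f ω n})
        ∩ ⋂ (m : ℕ) (_ : m < n), ({ω | p.Accepts f ω m} ∪ {ω | p.Rejects f ω m})ᶜ := by
    ext ω
    simp [sampleSize_eq_iff]
  rw [heq]
  refine .inter (.union (measurableSet_accepts f p le_rfl) (measurableSet_rejects f p le_rfl))
    (.iInter fun m => .iInter fun hm => .compl ?_)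
  exact .union (measurableSet_accepts f p hm.le) (measurableSet_rejects f p hm.le)

lemma decision_eq_one_iff {ω : ℕ → S} :
    p.decision f ω = 1 ↔ p.Rejects f ω (p.sampleSize f ω) := by
  unfold decision
  split_ifs with h <;> simp [h]

lemma decision_eq_zero_iff {ω : ℕ → S} :
    p.decision f ω = 0 ↔ ¬ p.Rejects f ω (p.sampleSize f ω) := by
  rw [← decision_eq_one_iff]
  omega

lemma measurableSet_sampleSize_decision (f : Fin 2 → ProbDensity ν) (p : GMTParams) (n : ℕ)
    (i : Fin 2) :
    MeasurableSet[obsSigma S n] {ω | p.sampleSize f ω = n ∧ p.decision f ω = i} := by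
  have hT := measurableSet_sampleSize_eq f p n
  have hR := measurableSet_rejects f p (le_refl n)
  fin_cases i
  · have heq : {ω | p.sampleSize f ω = n ∧ p.decision f ω = 0}
        = {ω | p.sampleSize f ω = n} ∩ {ω | p.Rejects f ω n}ᶜ := by
      ext ω
      simp only [decision_eq_zero_iff]
      exact ⟨fun h => ⟨h.1, fun hr => h.2 (by rw [h.1]; exact hr)⟩,
        fun h => ⟨h.1, fun hr => h.2 (by rw [← show _ = n from h.1]; exact hr)⟩⟩
    exact heq ▸ hT.inter hR.compl
  · have heq : {ω | p.sampleSize f ω = n ∧ p.decision f ω = 1}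
        = {ω | p.sampleSize f ω = n} ∩ {ω | p.Rejects f ω n} := by
      ext ω
      simp only [decision_eq_one_iff]
      exact ⟨fun h => ⟨h.1, by rw [← h.1]; exact h.2⟩,
        fun h => ⟨h.1, by rw [show _ = n from h.1]; exact h.2⟩⟩
    exact heq ▸ hT.inter hR

lemma IsAdmissible.one_le_N0 (hp : p.IsAdmissible) {j : ℕ} (hj : j ≤ p.K0) : 1 ≤ p.N0 j := by
  induction j with
  | zero => exact hp.pos0
  | succ j ih => exact (ih (by omega)).trans (hp.mono0 j (by omega))

lemma IsAdmissible.one_le_N1 (hp : p.IsAdmissible) {j : ℕ} (hj : j ≤ p.K1) : 1 ≤ p.N1 j := by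
  induction j with
  | zero => exact hp.pos1
  | succ j ih => exact (ih (by omega)).trans (hp.mono1 j (by omega))

lemma IsAdmissible.one_le_sampleSize (hp : p.IsAdmissible) (f : Fin 2 → ProbDensity ν)
    (ω : ℕ → S) : 1 ≤ p.sampleSize f ω := by
  have hN : 1 ≤ p.N := (hp.one_le_N0 le_rfl).trans hp.le_max0
  rcases sampleSize_spec f p ω with (⟨-, j, hj, h, -⟩ | ⟨h, -⟩) | (⟨-, j, hj, h, -⟩ | ⟨h, -⟩)
  · exact h ▸ hp.one_le_N0 hj
  · exact h ▸ hN
  · exact h ▸ hp.one_le_N1 hj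
  · exact h ▸ hN

lemma IsAdmissible.isTest (hp : p.IsAdmissible) (f : Fin 2 → ProbDensity ν) :
    IsTest (p.test f).1 (p.test f).2 where
  one_le ω := by
    have := hp.one_le_sampleSize f ω
    simpa [test] using this
  measurable_decision := by
    refine measurable_to_countable' fun i => ?_
    have heq : (p.test f).2 ⁻¹' {i}
        = ⋃ n : ℕ, {ω | p.sampleSize f ω = n ∧ p.decision f ω = i} := by
      ext ω
      simp [test]
    rw [heq]
    exact .iUnion fun n => obsSigma_le n _ (measurableSet_sampleSize_decision f p n i)
  measurableSet_stop n := by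
    simpa [test] using measurableSet_sampleSize_eq f p n
  measurableSet_stop_decision n i := by
    simpa [test] using measurableSet_sampleSize_decision f p n i

lemma measureReal_decision_one_le (f : Fin 2 → ProbDensity ν) (p : GMTParams)
    (P : Measure (ℕ → S)) [IsFiniteMeasure P] :
    P.real {ω | p.decision f ω = 1}
      ≤ ∑ j ∈ Finset.range (p.K1 + 1), P.real {ω | p.C1 j < avgLLR f (p.N1 j) ω}
        + P.real {ω | p.C < avgLLR f p.N ω} := by
  have hsub : {ω | p.decision f ω = 1}
      ⊆ (⋃ j ∈ Finset.range (p.K1 + 1), {ω | p.C1 j < avgLLR f (p.N1 j) ω})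
        ∪ {ω | p.C < avgLLR f p.N ω} := by
    intro ω hω
    rcases decision_eq_one_iff.1 hω with ⟨-, j, hj, h, hc⟩ | ⟨h, hc⟩
    · refine Or.inl ?_
      simp only [Set.mem_iUnion]
      refine ⟨j, by simp; omega, ?_⟩
      rw [← h] at hc
      exact hc
    · refine Or.inr ?_
      rw [h] at hc
      exact hc
  refine (measureReal_mono hsub).trans ((measureReal_union_le _ _).trans ?_)
  gcongr
  exact measureReal_biUnion_finset_le _ _

/-- If rejection is not called for at the stopping time, acceptance is, at one of the stages; a
union bound follows. -/
lemma measureReal_decision_zero_le (f : Fin 2 → ProbDensity ν) (p : GMTParams)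
    (P : Measure (ℕ → S)) [IsFiniteMeasure P] :
    P.real {ω | p.decision f ω = 0}
      ≤ ∑ j ∈ Finset.range (p.K0 + 1), P.real {ω | avgLLR f (p.N0 j) ω ≤ p.C0 j}
        + P.real {ω | avgLLR f p.N ω ≤ p.C} := by
  have hsub : {ω | p.decision f ω = 0}
      ⊆ (⋃ j ∈ Finset.range (p.K0 + 1), {ω | avgLLR f (p.N0 j) ω ≤ p.C0 j})
        ∪ {ω | avgLLR f p.N ω ≤ p.C} := by
    intro ω hω
    rcases (sampleSize_spec f p ω).resolve_right (decision_eq_zero_iff.1 hω) with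
      ⟨-, j, hj, h, hc⟩ | ⟨h, hc⟩
    · refine Or.inl ?_
      simp only [Set.mem_iUnion]
      refine ⟨j, by simp; omega, ?_⟩
      rw [← h] at hc
      exact hc
    · refine Or.inr ?_
      rw [h] at hc
      exact hc
  refine (measureReal_mono hsub).trans ((measureReal_union_le _ _).trans ?_)
  gcongr
  exact measureReal_biUnion_finset_le _ _

end GMTParams

/-- If a time `τ ≤ N` is at most `m j` unless the event `A j` happens, `0 ≤ j ≤ K`, then the mean of
`τ` is bounded through the probabilities of the `A j`. -/
lemma lintegral_le_of_stages {Ω : Type*} [MeasurableSpace Ω] (P : Measure Ω)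
    [IsProbabilityMeasure P] {τ : Ω → ℕ} {m : ℕ → ℕ} {K N : ℕ} {A : ℕ → Set Ω} {γ : ℕ → ℝ}
    (hA : ∀ j, MeasurableSet (A j)) (hN : ∀ ω, τ ω ≤ N) (hm : ∀ ω, ∀ j ≤ K, ω ∉ A j → τ ω ≤ m j)
    (hγ : ∀ j ≤ K, P.real (A j) ≤ γ j) :
    ∫⁻ ω, (τ ω : ℝ≥0∞) ∂P
      ≤ ENNReal.ofReal (m 0 + ∑ j ∈ Finset.Icc 1 K, (m j : ℝ) * γ (j - 1) + N * γ K) := by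
  -- Let `j` be the first index with `ω ∉ A j`: then `τ ω ≤ m j`, and `A (j - 1)` has occurred if `j
  -- ≥ 1`, so the term of `m j` is present. If there is no such `j`, the last term alone suffices.
  have hpt : ∀ ω, (τ ω : ℝ≥0∞) ≤ m 0
      + ∑ j ∈ Finset.Icc 1 K, (A (j - 1)).indicator (fun _ => (m j : ℝ≥0∞)) ω
      + (A K).indicator (fun _ => (N : ℝ≥0∞)) ω := by
    intro ω
    by_cases hex : ∃ j, j ≤ K ∧ ω ∉ A j
    · classical
      obtain ⟨hjK, hj⟩ := Nat.find_spec hex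
      have hmin := fun i => Nat.find_min (m := i) hex
      set j := Nat.find hex
      have hτ : (τ ω : ℝ≥0∞) ≤ m j := by exact_mod_cast hm ω j hjK hj
      rcases Nat.eq_zero_or_pos j with h0 | hpos
      · rw [h0] at hτ
        exact hτ.trans (le_self_add.trans le_self_add)
      · have hmem : ω ∈ A (j - 1) := by
          by_contra hnot
          exact hmin (j - 1) (by omega) ⟨by omega, hnot⟩
        have h1 : (m j : ℝ≥0∞)
            ≤ ∑ j ∈ Finset.Icc 1 K, (A (j - 1)).indicator (fun _ => (m j : ℝ≥0∞)) ω := by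
          have h2 := Finset.single_le_sum
            (f := fun j => (A (j - 1)).indicator (fun _ => (m j : ℝ≥0∞)) ω)
            (fun _ _ => zero_le) (Finset.mem_Icc.2 ⟨hpos, hjK⟩)
          simp only [Set.indicator_of_mem hmem] at h2
          exact h2
        exact (hτ.trans h1).trans (le_add_self.trans le_self_add)
    · push Not at hex
      have : (τ ω : ℝ≥0∞) ≤ N := by exact_mod_cast hN ω
      rw [Set.indicator_of_mem (hex K le_rfl)]
      exact this.trans le_add_self
  have hγ0 : ∀ j ≤ K, 0 ≤ γ j := fun j hj => measureReal_nonneg.trans (hγ j hj)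
  have hPA : ∀ j ≤ K, P (A j) ≤ ENNReal.ofReal (γ j) := fun j hj => by
    rw [← ofReal_measureReal]
    exact ENNReal.ofReal_le_ofReal (hγ j hj)
  refine (lintegral_mono hpt).trans ?_
  rw [lintegral_add_right _ (measurable_const.indicator (hA K)),
    lintegral_add_left measurable_const, lintegral_finsetSum _
      fun j _ => measurable_const.indicator (hA (j - 1)), lintegral_const, measure_univ, mul_one,
    lintegral_indicator_const (hA K)]
  have hsum0 : ∀ j ∈ Finset.Icc 1 K, 0 ≤ (m j : ℝ) * γ (j - 1) := fun j hj =>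
    mul_nonneg (Nat.cast_nonneg _) (hγ0 _ (by rw [Finset.mem_Icc] at hj; omega))
  rw [ENNReal.ofReal_add (add_nonneg (Nat.cast_nonneg _) (Finset.sum_nonneg hsum0))
      (mul_nonneg (Nat.cast_nonneg _) (hγ0 K le_rfl)),
    ENNReal.ofReal_add (Nat.cast_nonneg _) (Finset.sum_nonneg hsum0),
    ENNReal.ofReal_sum_of_nonneg hsum0, ENNReal.ofReal_natCast,
    ENNReal.ofReal_mul (Nat.cast_nonneg _), ENNReal.ofReal_natCast]
  refine add_le_add (add_le_add le_rfl (Finset.sum_le_sum fun j hj => ?_))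
    (mul_le_mul_right (hPA K le_rfl) _)
  rw [lintegral_indicator_const (hA _), ENNReal.ofReal_mul (Nat.cast_nonneg _),
    ENNReal.ofReal_natCast]
  exact mul_le_mul_right (hPA _ (by rw [Finset.mem_Icc] at hj; omega)) _

/-- Only the bound `2 * q` is needed; the factor `1 - q ^ K` lets the induction close. -/
lemma sum_Icc_pow_le {q : ℝ} (hq0 : 0 ≤ q) (hq : q ≤ 1 / 4) (K : ℕ) :
    ∑ j ∈ Finset.Icc 1 K, q ^ j ≤ 2 * q * (1 - q ^ K) := by
  induction K with
  | zero => simp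
  | succ K ih =>
    rw [Finset.sum_Icc_succ_top (by omega)]
    have : 0 ≤ q ^ K := by positivity
    have h2 : q ^ (K + 1) = q * q ^ K := by ring
    rw [h2]
    have : 0 ≤ q * q ^ K * (1 - 2 * q) := mul_nonneg (by positivity) (by linarith)
    nlinarith

/-- The later stages spend at most `x / 2` of the budget `3 * x / 4`, so at least `x / 4` is left
for the first. -/
lemma remainingError_mem {x : ℝ} (hx : x ∈ Set.Ioo (0 : ℝ) 1) (K : ℕ) :
    remainingError x K ∈ Set.Icc (x / 4) (3 * x / 4) := by
  have hq0 : 0 ≤ x / 4 := by linarith [hx.1]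
  have h1 := sum_Icc_pow_le hq0 (by linarith [hx.2]) K
  have h2 : 0 ≤ ∑ j ∈ Finset.Icc 1 K, (x / 4) ^ j := Finset.sum_nonneg fun j _ => by positivity
  have h3 : 0 ≤ (x / 4) ^ K := by positivity
  unfold remainingError
  constructor <;> nlinarith

lemma activeError_pos {x : ℝ} (hx : x ∈ Set.Ioo (0 : ℝ) 1) (K j : ℕ) : 0 < activeError x K j := by
  have := (remainingError_mem hx K).1
  have := hx.1
  unfold activeError
  split_ifs
  · linarith
  · positivity

lemma activeError_le {x : ℝ} (hx : x ∈ Set.Ioo (0 : ℝ) 1) (K j : ℕ) :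
    activeError x K j ≤ 3 * x / 4 := by
  have := hx.1
  unfold activeError
  split_ifs with hj
  · exact (remainingError_mem hx K).2
  · have : (x / 4) ^ j ≤ x / 4 := pow_le_of_le_one (by linarith) (by linarith [hx.2]) hj
    linarith

lemma sum_activeError (x : ℝ) (K : ℕ) :
    ∑ j ∈ Finset.range (K + 1), activeError x K j = 3 * x / 4 := by
  have h1 : Finset.range (K + 1) = insert 0 (Finset.Icc 1 K) := by
    ext j
    simp
    omega
  rw [h1, Finset.sum_insert (by simp)]
  have h2 : ∑ j ∈ Finset.Icc 1 K, activeError x K j = ∑ j ∈ Finset.Icc 1 K, (x / 4) ^ j := by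
    refine Finset.sum_congr rfl fun j hj => ?_
    rw [Finset.mem_Icc] at hj
    rw [activeError, if_neg (by omega)]
  rw [h2, activeError, if_pos rfl, remainingError]
  ring

lemma matchedSeq_zero (g x : ℝ) : matchedSeq g x 0 = g := if_pos rfl

lemma matchedSeq_of_pos (g x : ℝ) {j : ℕ} (hj : 1 ≤ j) : matchedSeq g x j = (x / 4) ^ j :=
  if_neg (by omega)

lemma activeError_of_pos (x : ℝ) (K : ℕ) {j : ℕ} (hj : 1 ≤ j) :
    activeError x K j = (x / 4) ^ j :=
  if_neg (by omega)

lemma matchedSeq_mem {g x : ℝ} (hg : g ∈ Set.Ioo (0 : ℝ) 1) (hx : x ∈ Set.Ioo (0 : ℝ) 1) (j : ℕ) :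
    matchedSeq g x j ∈ Set.Ioo (0 : ℝ) 1 := by
  have := hx.1
  unfold matchedSeq
  split_ifs with hj
  · exact hg
  · exact ⟨by positivity, pow_lt_one₀ (by linarith) (by linarith [hx.2]) hj⟩

/-- The largest number of stages subject to the two constraints is attained, and one more stage
violates one of them. -/
lemma sSup_stages_spec (φ : ℕ → ℕ) {q u : ℝ} {M : ℕ} (hq0 : 0 ≤ q) (hq1 : q < 1) (hu0 : 0 < u)
    (hu1 : u ≤ 1) (hM : φ 0 ≤ M) :
    (φ (sSup {j | φ j ≤ M ∧ u ≤ q ^ j}) ≤ M ∧ u ≤ q ^ sSup {j | φ j ≤ M ∧ u ≤ q ^ j}) ∧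
    (M < φ (sSup {j | φ j ≤ M ∧ u ≤ q ^ j} + 1) ∨ q ^ (sSup {j | φ j ≤ M ∧ u ≤ q ^ j} + 1) < u) := by
  obtain ⟨n, hn⟩ := exists_pow_lt_of_lt_one hu0 hq1
  have hbdd : BddAbove {j | φ j ≤ M ∧ u ≤ q ^ j} := by
    refine ⟨n, fun j hj => le_of_not_gt fun hnj => ?_⟩
    exact (hj.2.trans (pow_le_pow_of_le_one hq0 hq1.le hnj.le)).not_gt hn
  have hne : {j | φ j ≤ M ∧ u ≤ q ^ j}.Nonempty := ⟨0, hM, by simpa using hu1⟩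
  refine ⟨Nat.sSup_mem hne hbdd, ?_⟩
  by_contra hcon
  push Not at hcon
  have := le_csSup hbdd (show sSup {j | φ j ≤ M ∧ u ≤ q ^ j} + 1 ∈ {j | φ j ≤ M ∧ u ≤ q ^ j}
    from hcon)
  omega

namespace TiltedPairs

variable {f : Fin 2 → ProbDensity ν} {I0 I1 α β g0 g1 : ℝ}

lemma kHat0_spec (h : TiltedPairs f I0 I1) (hα : α ∈ Set.Ioo (0 : ℝ) 1)
    (hβ : β ∈ Set.Ioo (0 : ℝ) 1) :
    (nStar f ((β / 4) ^ KHat0 f α β) ((β / 4) ^ KHat0 f α β) ≤ nStar f (α / 4) (β / 4) ∧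
      3 * α / 4 ≤ (β / 4) ^ KHat0 f α β) ∧
    (nStar f (α / 4) (β / 4) < nStar f ((β / 4) ^ (KHat0 f α β + 1)) ((β / 4) ^ (KHat0 f α β + 1)) ∨
      (β / 4) ^ (KHat0 f α β + 1) < 3 * α / 4) := by
  have hα0 := hα.1; have hα1 := hα.2; have hβ0 := hβ.1; have hβ1 := hβ.2
  refine sSup_stages_spec (fun j => nStar f ((β / 4) ^ j) ((β / 4) ^ j)) (by positivity)
    (by linarith) (by positivity) (by linarith) ?_
  simpa using (nStar_one f).trans (h.nStar_spec (by positivity) (by positivity)).1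

lemma kHat1_spec (h : TiltedPairs f I0 I1) (hα : α ∈ Set.Ioo (0 : ℝ) 1)
    (hβ : β ∈ Set.Ioo (0 : ℝ) 1) :
    (nStar f ((α / 4) ^ KHat1 f α β) ((α / 4) ^ KHat1 f α β) ≤ nStar f (α / 4) (β / 4) ∧
      3 * β / 4 ≤ (α / 4) ^ KHat1 f α β) ∧
    (nStar f (α / 4) (β / 4) < nStar f ((α / 4) ^ (KHat1 f α β + 1)) ((α / 4) ^ (KHat1 f α β + 1)) ∨
      (α / 4) ^ (KHat1 f α β + 1) < 3 * β / 4) := by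
  have hα0 := hα.1; have hα1 := hα.2; have hβ0 := hβ.1; have hβ1 := hβ.2
  refine sSup_stages_spec (fun j => nStar f ((α / 4) ^ j) ((α / 4) ^ j)) (by positivity)
    (by linarith) (by positivity) (by linarith) ?_
  simpa using (nStar_one f).trans (h.nStar_spec (by positivity) (by positivity)).1

/-- Both error levels decrease along the stages, so the sizes increase. The last stage fits below
`N` by the constraint defining the number of stages or, when there are no additional ones, because
its levels are at least `α / 4` and `β / 4`. For equal sizes, thresholds are ordered by type-I
level: at most `3 * α / 4` for a rejection stage and at least that for an acceptance stage. -/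
lemma isAdmissible_gmtHat (h : TiltedPairs f I0 I1) (hα : α ∈ Set.Ioo (0 : ℝ) 1)
    (hβ : β ∈ Set.Ioo (0 : ℝ) 1) (hg0 : g0 ∈ Set.Ioo (max (3 * α) β / 4) 1)
    (hg1 : g1 ∈ Set.Ioo (max α (3 * β) / 4) 1) : (gmtHat f α β g0 g1).IsAdmissible := by
  have hα0 := hα.1; have hα1 := hα.2; have hβ0 := hβ.1; have hβ1 := hβ.2
  have hg0α : 3 * α / 4 ≤ g0 := (div_le_div_of_nonneg_right (le_max_left _ _) (by norm_num)).trans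
    hg0.1.le
  have hg0β : β / 4 ≤ g0 := (div_le_div_of_nonneg_right (le_max_right _ _) (by norm_num)).trans
    hg0.1.le
  have hg1α : α / 4 ≤ g1 := (div_le_div_of_nonneg_right (le_max_left _ _) (by norm_num)).trans
    hg1.1.le
  have hg1β : 3 * β / 4 ≤ g1 :=
    (div_le_div_of_nonneg_right (le_max_right _ _) (by norm_num)).trans hg1.1.le
  have hg0' : g0 ∈ Set.Ioo (0 : ℝ) 1 := ⟨by linarith, hg0.2⟩
  have hg1' : g1 ∈ Set.Ioo (0 : ℝ) 1 := ⟨by linarith, hg1.2⟩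
  have hm0 := matchedSeq_mem hg0' hβ
  have hm1 := matchedSeq_mem hg1' hα
  obtain ⟨⟨hK0, hK0'⟩, -⟩ := h.kHat0_spec hα hβ
  obtain ⟨⟨hK1, hK1'⟩, -⟩ := h.kHat1_spec hα hβ
  have step : ∀ {g x : ℝ} (K j : ℕ), x ∈ Set.Ioo (0 : ℝ) 1 → x / 4 ≤ g →
      matchedSeq g x (j + 1) ≤ matchedSeq g x j ∧
        activeError x K (j + 1) ≤ activeError x K j := by
    intro g x K j hx hgx
    have hx0 := hx.1
    rw [matchedSeq_of_pos _ _ (by omega), activeError_of_pos _ _ (by omega)]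
    rcases Nat.eq_zero_or_pos j with rfl | hj
    · rw [matchedSeq_zero, zero_add, pow_one, activeError, if_pos rfl]
      exact ⟨hgx, (remainingError_mem hx K).1⟩
    · rw [matchedSeq_of_pos _ _ hj, activeError_of_pos _ _ hj]
      have := pow_le_pow_of_le_one (by positivity : 0 ≤ x / 4) (by linarith [hx.2]) (Nat.le_succ j)
      exact ⟨this, this⟩
  refine ⟨?_, ?_, fun j _ => ?_, fun j _ => ?_, ?_, ?_, fun j hj k hk hjk => ?_⟩
  · exact (h.nStar_spec (hm0 0).1 (activeError_pos hβ _ 0)).1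
  · exact (h.nStar_spec (activeError_pos hα _ 0) (hm1 0).1).1
  · exact h.nStar_anti (hm0 _).1 (activeError_pos hβ _ _) (step 0 j hβ hg0β).1
      (step _ j hβ hg0β).2
  · exact h.nStar_anti (activeError_pos hα _ _) (hm1 _).1 (step _ j hα hg1α).2
      (step 0 j hα hg1α).1
  · change nStar f (matchedSeq g0 β (KHat0 f α β)) (activeError β (KHat0 f α β) (KHat0 f α β))
      ≤ nStar f (α / 4) (β / 4)
    rcases Nat.eq_zero_or_pos (KHat0 f α β) with h0 | hpos
    · rw [h0, matchedSeq_zero, activeError, if_pos rfl]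
      exact h.nStar_anti (by positivity) (by positivity) (by linarith) (remainingError_mem hβ 0).1
    · rwa [matchedSeq_of_pos _ _ hpos, activeError_of_pos _ _ hpos]
  · change nStar f (activeError α (KHat1 f α β) (KHat1 f α β)) (matchedSeq g1 α (KHat1 f α β))
      ≤ nStar f (α / 4) (β / 4)
    rcases Nat.eq_zero_or_pos (KHat1 f α β) with h0 | hpos
    · rw [h0, matchedSeq_zero, activeError, if_pos rfl]
      exact h.nStar_anti (by positivity) (by positivity) (remainingError_mem hα 0).1 (by linarith)
    · rwa [matchedSeq_of_pos _ _ hpos, activeError_of_pos _ _ hpos]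
  · change j ≤ KHat0 f α β at hj
    change nStar f (matchedSeq g0 β j) (activeError β (KHat0 f α β) j)
      = nStar f (activeError α (KHat1 f α β) k) (matchedSeq g1 α k) at hjk
    change cStar f (matchedSeq g0 β j) (activeError β (KHat0 f α β) j)
      ≤ cStar f (activeError α (KHat1 f α β) k) (matchedSeq g1 α k)
    have hγ : 3 * α / 4 ≤ matchedSeq g0 β j := by
      rcases Nat.eq_zero_or_pos j with rfl | hpos
      · rwa [matchedSeq_zero]
      · rw [matchedSeq_of_pos _ _ hpos]
        exact hK0'.trans (pow_le_pow_of_le_one (by positivity) (by linarith) hj)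
    have hact := activeError_le hα (KHat1 f α β) k
    obtain ⟨-, hleast⟩ := h.cStar_spec (hm0 j).1 (hm0 j).2 (activeError_pos hβ (KHat0 f α β) j)
    obtain ⟨hctrl, -⟩ := h.cStar_spec (activeError_pos hα (KHat1 f α β) k) (by linarith) (hm1 k).1
    rw [← hleast, hjk]
    exact hctrl.1.trans (hact.trans hγ)

lemma test_gmtHat_mem_testClass (h : TiltedPairs f I0 I1) (hα : α ∈ Set.Ioo (0 : ℝ) 1)
    (hβ : β ∈ Set.Ioo (0 : ℝ) 1) (hg0 : g0 ∈ Set.Ioo (max (3 * α) β / 4) 1)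
    (hg1 : g1 ∈ Set.Ioo (max α (3 * β) / 4) 1) :
    (gmtHat f α β g0 g1).test f ∈ testClass f α β := by
  have hα0 := hα.1; have hα1 := hα.2; have hβ0 := hβ.1; have hβ1 := hβ.2
  have hg0' : g0 ∈ Set.Ioo (0 : ℝ) 1 := ⟨lt_of_le_of_lt (by positivity) hg0.1, hg0.2⟩
  have hg1' : g1 ∈ Set.Ioo (0 : ℝ) 1 := ⟨lt_of_le_of_lt (by positivity) hg1.1, hg1.2⟩
  have hm0 := matchedSeq_mem hg0' hβ
  have hm1 := matchedSeq_mem hg1' hα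
  obtain ⟨hN, -⟩ := h.cStar_spec (by positivity : 0 < α / 4) (by linarith)
    (by positivity : 0 < β / 4)
  refine ⟨(h.isAdmissible_gmtHat hα hβ hg0 hg1).isTest f,
    (GMTParams.measureReal_decision_one_le f _ _).trans ?_,
    (GMTParams.measureReal_decision_zero_le f _ _).trans ?_⟩
  · calc _ ≤ ∑ j ∈ Finset.range (KHat1 f α β + 1), activeError α (KHat1 f α β) j + α / 4 := by
          refine add_le_add (Finset.sum_le_sum fun j _ => ?_) hN.1
          exact (h.cStar_spec (activeError_pos hα _ j)
            ((activeError_le hα _ j).trans_lt (by linarith)) (hm1 j).1).1.1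
      _ = α := by rw [sum_activeError]; ring
  · calc _ ≤ ∑ j ∈ Finset.range (KHat0 f α β + 1), activeError β (KHat0 f α β) j + β / 4 := by
          refine add_le_add (Finset.sum_le_sum fun j _ => ?_) hN.2
          exact (h.cStar_spec (hm0 j).1 (hm0 j).2 (activeError_pos hβ _ j)).1.2
      _ = β := by rw [sum_activeError]; ring

/-- Under the null only failures to accept matter: `A j` is the type-I error event of the `j`-th
acceptance stage, whose level is `matchedSeq g0 β j`. -/
lemma expSampleSize_null_le (h : TiltedPairs f I0 I1) (hβ : β ∈ Set.Ioo (0 : ℝ) 1)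
    (hg0 : g0 ∈ Set.Ioo (0 : ℝ) 1) :
    expSampleSize f 0 ((gmtHat f α β g0 g1).test f).1
      ≤ ENNReal.ofReal (essBound0 f α β (matchedSeq g0 β) (KHat0 f α β)) := by
  set p := gmtHat f α β g0 g1
  have hm0 := matchedSeq_mem hg0 hβ
  have := lintegral_le_of_stages (pathLaw f 0) (τ := p.sampleSize f) (m := p.N0) (K := p.K0)
    (N := p.N) (A := fun j => {ω | p.C0 j < avgLLR f (p.N0 j) ω}) (γ := matchedSeq g0 β)
    (fun j => measurableSet_lt measurable_const (measurable_avgLLR f _))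
    (GMTParams.sampleSize_le_max f p)
    (fun ω j hj hω => GMTParams.sampleSize_le_of_accept hj (not_lt.1 hω))
    (fun j _ => (h.cStar_spec (hm0 j).1 (hm0 j).2 (activeError_pos hβ _ j)).1.1)
  refine le_trans (le_of_eq ?_) (this.trans_eq ?_)
  · simp [expSampleSize, GMTParams.test]
  · congr 1
    unfold essBound0
    congr 2
    refine Finset.sum_congr rfl fun j hj => ?_
    rw [← activeError_of_pos β (KHat0 f α β) (Finset.mem_Icc.1 hj).1]
    rfl

lemma expSampleSize_alt_le (h : TiltedPairs f I0 I1) (hα : α ∈ Set.Ioo (0 : ℝ) 1)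
    (hg1 : g1 ∈ Set.Ioo (0 : ℝ) 1) :
    expSampleSize f 1 ((gmtHat f α β g0 g1).test f).1
      ≤ ENNReal.ofReal (essBound1 f α β (matchedSeq g1 α) (KHat1 f α β)) := by
  set p := gmtHat f α β g0 g1
  have hm1 := matchedSeq_mem hg1 hα
  have := lintegral_le_of_stages (pathLaw f 1) (τ := p.sampleSize f) (m := p.N1) (K := p.K1)
    (N := p.N) (A := fun j => {ω | avgLLR f (p.N1 j) ω ≤ p.C1 j}) (γ := matchedSeq g1 α)
    (fun j => measurableSet_le (measurable_avgLLR f _) measurable_const)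
    (GMTParams.sampleSize_le_max f p)
    (fun ω j hj hω => GMTParams.sampleSize_le_of_reject hj (not_le.1 hω))
    (fun j _ => (h.cStar_spec (activeError_pos hα _ j)
      ((activeError_le hα _ j).trans_lt (by linarith [hα.2])) (hm1 j).1).1.2)
  refine le_trans (le_of_eq ?_) (this.trans_eq ?_)
  · simp [expSampleSize, GMTParams.test]
  · congr 1
    unfold essBound1
    congr 2
    refine Finset.sum_congr rfl fun j hj => ?_
    rw [← activeError_of_pos α (KHat1 f α β) (Finset.mem_Icc.1 hj).1]
    rfl

end TiltedPairs

end Multistage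

/-! ### Asymptotics of the upper bounds, and the comparison with the optimum. -/

section Asymptotics

lemma sum_mul_matchedSeq_le {g x : ℝ} (hx : x ∈ Set.Ioo (0 : ℝ) 1) (hg : 0 < g) (K : ℕ) :
    ∑ j ∈ Finset.Icc 1 K, (j : ℝ) * matchedSeq g x (j - 1) + (K + 2) * matchedSeq g x K
      ≤ 2 * g + 2 * x := by
  have hx0 := hx.1
  -- Passing from `K` to `K + 1` adds `(K + 3) * (x / 4) ^ (K + 1)` minus a nonnegative weight. This
  -- is at most `x / 4 * 3 * (1 / 2) ^ K`, exactly the growth of the strengthened right-hand side.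
  suffices H : ∀ K : ℕ, ∑ j ∈ Finset.Icc 1 K, (j : ℝ) * matchedSeq g x (j - 1)
      + (K + 2) * matchedSeq g x K ≤ 2 * g + x / 4 * (8 - 6 * (1 / 2) ^ K) by
    refine (H K).trans ?_
    have : (0 : ℝ) ≤ (1 / 2) ^ K := by positivity
    nlinarith
  intro K
  induction K with
  | zero =>
    simp only [Finset.Icc_eq_empty_of_lt zero_lt_one, Finset.sum_empty, CharP.cast_eq_zero,
      matchedSeq_zero, pow_zero]
    linarith
  | succ K ih =>
    rw [Finset.sum_Icc_succ_top (by omega), Nat.add_sub_cancel,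
      matchedSeq_of_pos g x (j := K + 1) (by omega)]
    have hK : (0 : ℝ) ≤ matchedSeq g x K := by
      unfold matchedSeq
      split_ifs <;> positivity
    have h1 : ((K : ℝ) + 3) ≤ 3 * 2 ^ K := by
      have : K + 1 ≤ 2 ^ K := Nat.lt_two_pow_self
      have : (K : ℝ) + 1 ≤ 2 ^ K := by exact_mod_cast this
      linarith [(Nat.cast_nonneg K : (0 : ℝ) ≤ K)]
    have h2 : ((K : ℝ) + 3) * (x / 4) ^ (K + 1) ≤ x / 4 * (3 * (1 / 2) ^ K) := by
      calc ((K : ℝ) + 3) * (x / 4) ^ (K + 1) = x / 4 * (((K : ℝ) + 3) * (x / 4) ^ K) := by ring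
        _ ≤ x / 4 * (3 * 2 ^ K * (1 / 4) ^ K) := by
          gcongr
          exact hx.2.le
        _ = x / 4 * (3 * (1 / 2) ^ K) := by
          rw [mul_assoc, ← mul_pow]
          norm_num
    have h3 : ((1 : ℝ) / 2) ^ (K + 1) = (1 / 2) ^ K / 2 := by ring
    rw [h3]
    push_cast
    nlinarith

/-- The bound on the expected sample size, apart from its first term, is of smaller order than
`|log x|`. -/
lemma stages_bound_le {g x B M first : ℝ} {nn : ℕ → ℝ} {K : ℕ} (hx : x ∈ Set.Ioo (0 : ℝ) 1)
    (hg : 0 < g) (hB : 0 ≤ B) (hnn : ∀ j ∈ Finset.Icc 1 K, nn j ≤ j * B) (hM : M ≤ (K + 2) * B) :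
    first + ∑ j ∈ Finset.Icc 1 K, nn j * matchedSeq g x (j - 1) + M * matchedSeq g x K
      ≤ first + B * (2 * g + 2 * x) := by
  have hγ : ∀ j, 0 ≤ matchedSeq g x j := fun j => by
    have := hx.1
    unfold matchedSeq
    split_ifs <;> positivity
  have h1 : ∑ j ∈ Finset.Icc 1 K, nn j * matchedSeq g x (j - 1)
      ≤ B * ∑ j ∈ Finset.Icc 1 K, (j : ℝ) * matchedSeq g x (j - 1) := by
    rw [Finset.mul_sum]
    refine Finset.sum_le_sum fun j hj => ?_
    have := mul_le_mul_of_nonneg_right (hnn j hj) (hγ (j - 1))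
    linarith
  have h2 := mul_le_mul_of_nonneg_right hM (hγ K)
  have h3 := mul_le_mul_of_nonneg_left (sum_mul_matchedSeq_le hx hg K) hB
  linarith

lemma abs_log_div_four {x : ℝ} (hx : x ∈ Set.Ioo (0 : ℝ) 1) :
    |Real.log x| ≤ |Real.log (x / 4)| ∧ |Real.log (x / 4)| ≤ |Real.log x| + 2 := by
  have hx0 := hx.1
  rw [abs_of_neg (Real.log_neg hx.1 hx.2),
    abs_of_neg (Real.log_neg (by positivity) (by linarith [hx.2] : x / 4 < 1)),
    Real.log_div hx.1.ne' (by norm_num)]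
  have h4 : Real.log 4 = 2 * Real.log 2 := by
    rw [show (4 : ℝ) = 2 ^ 2 by norm_num, Real.log_pow]
    norm_num
  have := Real.log_two_lt_d9
  have := Real.log_pos one_lt_two
  constructor <;> linarith

lemma exists_lt_abs_log (A : ℝ) : ∃ δ ∈ Set.Ioo (0 : ℝ) 1, ∀ x ∈ Set.Ioo 0 δ, A < |Real.log x| := by
  have h : ∀ᶠ x in 𝓝[>] (0 : ℝ), A < |Real.log x| :=
    (tendsto_abs_atBot_atTop.comp Real.tendsto_log_nhdsGT_zero).eventually_gt_atTop A
  obtain ⟨δ, hδ, hsub⟩ := mem_nhdsGT_iff_exists_Ioo_subset.1 h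
  refine ⟨min δ (1 / 2), ⟨lt_min hδ (by norm_num), (min_le_right _ _).trans_lt (by norm_num)⟩,
    fun x hx => hsub ⟨hx.1, hx.2.trans_le (min_le_left _ _)⟩⟩

/-- Collects the lower-order terms of the bound on the expected sample size. -/
lemma exists_lower_order_le {I C ε : ℝ} (hI : 0 < I) (hC : 0 < C) (hε : 0 < ε) :
    ∃ δ ∈ Set.Ioo (0 : ℝ) 1, ∀ x ∈ Set.Ioo 0 δ, ∀ g ∈ Set.Ioo 0 δ,
      (1 + ε / 4) * (|Real.log (x / 4)| / I) + 1 + (C * |Real.log (x / 4)| + 1) * (2 * g + 2 * x)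
        ≤ (1 + ε) * (|Real.log x| / I) := by
  -- This size of `L = |log x|` gives `(1 + ε / 2) * (L + 2) + 2 * I ≤ (1 + ε) * L`. The bound `ε /
  -- (16 * I * C)` below caps the weighted stages by `ε / 4` of the main term.
  obtain ⟨δ₁, hδ₁, hlog⟩ := exists_lt_abs_log ((2 * (1 + ε / 2) + 2 * I) / (ε / 2))
  refine ⟨min δ₁ (min (1 / 4) (ε / (16 * I * C))), ⟨lt_min hδ₁.1 (by positivity),
    (min_le_left _ _).trans_lt hδ₁.2⟩, fun x hx g hg => ?_⟩
  have hx1 : x < δ₁ := hx.2.trans_le (min_le_left _ _)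
  have hs1 : 2 * g + 2 * x ≤ 1 := by
    have h1 := hx.2.trans_le ((min_le_right _ _).trans (min_le_left _ _))
    have h2 := hg.2.trans_le ((min_le_right _ _).trans (min_le_left _ _))
    linarith
  have hs2 : 2 * g + 2 * x ≤ 4 * (ε / (16 * I * C)) := by
    have h1 := hx.2.trans_le ((min_le_right _ _).trans (min_le_right _ _))
    have h2 := hg.2.trans_le ((min_le_right _ _).trans (min_le_right _ _))
    linarith
  have hL := hlog x ⟨hx.1, hx1⟩
  rw [div_lt_iff₀ (by positivity)] at hL
  have hL' := (abs_log_div_four ⟨hx.1, hx1.trans hδ₁.2⟩).2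
  set L := |Real.log x|
  set L' := |Real.log (x / 4)|
  have hL'0 : 0 ≤ L' := abs_nonneg _
  have h1 : C * L' * (2 * g + 2 * x) ≤ ε / 4 * (L' / I) := by
    calc C * L' * (2 * g + 2 * x) ≤ C * L' * (4 * (ε / (16 * I * C))) := by gcongr
      _ = ε / 4 * (L' / I) := by field_simp; ring
  have h2 : (1 + ε / 2) * (L' / I) + 2 ≤ (1 + ε) * (L / I) := by
    rw [← mul_div_assoc, ← mul_div_assoc, div_add' _ _ _ hI.ne']
    gcongr
    nlinarith
  linarith

/-- Comparison points for the minimizer: they vanish, but slower than any power of `x`. -/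
lemma exists_comparison {δ : ℝ} (hδ : 0 < δ) :
    ∃ δ' ∈ Set.Ioo (0 : ℝ) 1, ∀ x ∈ Set.Ioo 0 δ', ∀ y ∈ Set.Ioo 0 δ', ∃ g : ℝ,
      max (3 * y) x / 4 < g ∧ g < 1 ∧ g < δ ∧ |Real.log g| / |Real.log x| < δ := by
  have hlim : Tendsto (fun L : ℝ => Real.log L / L) atTop (𝓝 0) := by
    simpa using Real.tendsto_pow_log_div_mul_add_atTop 1 0 1 one_ne_zero
  obtain ⟨A, hA⟩ := eventually_atTop.1 (hlim.eventually_lt_const hδ)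
  obtain ⟨δ₁, hδ₁, hlog⟩ := exists_lt_abs_log (max A (max 1 δ⁻¹))
  refine ⟨min δ₁ δ, ⟨lt_min hδ₁.1 hδ, (min_le_left _ _).trans_lt hδ₁.2⟩, fun x hx y hy => ?_⟩
  have hx1 : x < δ₁ := hx.2.trans_le (min_le_left _ _)
  have hy1 : y < δ₁ := hy.2.trans_le (min_le_left _ _)
  have hL := hlog x ⟨hx.1, hx1⟩
  have habs : |Real.log x| = -Real.log x := abs_of_neg (Real.log_neg hx.1 (hx1.trans hδ₁.2))
  set L := |Real.log x| with hLdef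
  obtain ⟨hLA, hL1, hLδ⟩ : A < L ∧ 1 < L ∧ δ⁻¹ < L := by
    simpa [max_lt_iff] using hL
  have hL0 : 0 < L := by linarith
  have hg1 : max y L⁻¹ < 1 := max_lt (hy1.trans hδ₁.2) (inv_lt_one_of_one_lt₀ hL1)
  have hg0 : 0 < max y L⁻¹ := lt_max_of_lt_left hy.1
  -- The entry `y` clears `3 * y / 4`, however large `y` is compared with `x`; the entry `L⁻¹`
  -- clears `x / 4` and keeps `|log g| ≤ log L`, which is negligible against `L`.
  refine ⟨max y L⁻¹, ?_, hg1, max_lt (hy.2.trans_le (min_le_right _ _))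
    (inv_lt_of_inv_lt₀ hδ hLδ), ?_⟩
  · have hxL : x ≤ L⁻¹ := by
      have h1 := Real.add_one_le_exp L
      rw [habs, Real.exp_neg, Real.exp_log hx.1, ← habs] at h1
      have h2 : L ≤ x⁻¹ := by linarith
      exact (le_inv_comm₀ hL0 hx.1).1 h2
    have h1 := le_max_left y L⁻¹
    have h2 := hxL.trans (le_max_right y L⁻¹)
    rw [div_lt_iff₀ (by norm_num)]
    exact max_lt (by linarith) (by linarith)
  · refine lt_of_le_of_lt ?_ (hA L hLA.le)
    gcongr
    rw [abs_of_neg (Real.log_neg hg0 hg1), neg_le, ← Real.log_inv]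
    exact Real.log_le_log (inv_pos.2 hL0) (le_max_right _ _)

variable {S : Type*} [MeasurableSpace S] {ν : Measure S}

namespace TiltedPairs

variable {f : Fin 2 → ProbDensity ν} {I0 I1 : ℝ}

/-- The sizes of the stages, and the size of the final stage if one more stage would violate one
of the two constraints on the number of stages. -/
lemma exists_nStar_stage_le (h : TiltedPairs f I0 I1) :
    ∃ C > 0, ∀ x ∈ Set.Ioo (0 : ℝ) 1,
      (∀ j : ℕ, 1 ≤ j → (nStar f ((x / 4) ^ j) ((x / 4) ^ j) : ℝ)
        ≤ j * (C * |Real.log (x / 4)| + 1)) ∧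
      ∀ (K : ℕ) (a b : ℝ), (nStar f a b < nStar f ((x / 4) ^ (K + 1)) ((x / 4) ^ (K + 1)) ∨
          (x / 4) ^ (K + 2) ≤ a ∧ (x / 4) ^ (K + 2) ≤ b) →
        (nStar f a b : ℝ) ≤ (K + 2) * (C * |Real.log (x / 4)| + 1) := by
  obtain ⟨C, hC, H⟩ := h.exists_nStar_le_log
  refine ⟨C, hC, fun x hx => ?_⟩
  have hq0 : 0 < x / 4 := by linarith [hx.1]
  have hpow : ∀ (j : ℕ) (a b : ℝ), 1 ≤ j → (x / 4) ^ j ≤ a → (x / 4) ^ j ≤ b →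
      (nStar f a b : ℝ) ≤ j * (C * |Real.log (x / 4)| + 1) := by
    intro j a b hj ha hb
    have hj' : (1 : ℝ) ≤ j := by exact_mod_cast hj
    refine (H _ ⟨by positivity, pow_le_one₀ hq0.le (by linarith [hx.2])⟩ a b ha hb).1.trans ?_
    rw [Real.log_pow, abs_mul, Nat.abs_cast]
    linarith
  refine ⟨fun j hj => hpow j _ _ hj le_rfl le_rfl, fun K a b hab => ?_⟩
  rcases hab with hlt | ⟨ha, hb⟩
  · have h1 : (nStar f a b : ℝ) ≤ nStar f ((x / 4) ^ (K + 1)) ((x / 4) ^ (K + 1)) := by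
      exact_mod_cast hlt.le
    have h2 := hpow (K + 1) _ _ (by omega) le_rfl le_rfl
    have h3 : 0 ≤ C * |Real.log (x / 4)| := by positivity
    push_cast at h2
    linarith
  · have := hpow (K + 2) a b (by omega) ha hb
    push_cast at this
    exact this

/-- No relation between `α` and `β` is needed: besides the number of stages, `α` enters only through
the final size, which maximality of `KHat0` bounds in terms of `β` and that number. -/
lemma exists_essBound0_le (h : TiltedPairs f I0 I1) :
    ∃ C > 0, ∀ α ∈ Set.Ioo (0 : ℝ) 1, ∀ β ∈ Set.Ioo (0 : ℝ) 1, ∀ g > 0,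
      essBound0 f α β (matchedSeq g β) (KHat0 f α β)
        ≤ nStar f g (β / 4) + (C * |Real.log (β / 4)| + 1) * (2 * g + 2 * β) := by
  obtain ⟨C, hC, H⟩ := h.exists_nStar_stage_le
  refine ⟨C, hC, fun α hα β hβ g hg => ?_⟩
  obtain ⟨H1, H2⟩ := H β hβ
  have hα0 := hα.1; have hβ0 := hβ.1; have hβ1 := hβ.2
  have hq : β / 4 ≤ 1 := by linarith
  refine (stages_bound_le (nn := fun j => nStar f (matchedSeq g β j) ((β / 4) ^ j))
    (B := C * |Real.log (β / 4)| + 1) hβ hg (by positivity) (fun j hj => ?_)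
    (H2 (KHat0 f α β) _ _ ?_)).trans ?_
  · rw [Finset.mem_Icc] at hj
    simp only [matchedSeq_of_pos g β hj.1]
    exact H1 j hj.1
  -- If the stage `K + 1` has level below `3 * α / 4`, one more factor `β / 4 ≤ 1 / 4` brings it
  -- below `α / 4`. This is the source of `K + 2`.
  · refine (h.kHat0_spec hα hβ).2.imp_right fun hlt => ⟨?_, ?_⟩
    · have h0 : 0 < (β / 4) ^ (KHat0 f α β + 1) := by positivity
      rw [pow_succ]
      nlinarith
    · exact pow_le_of_le_one (by positivity) hq (by omega)
  · rw [matchedSeq_zero]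
    gcongr
    exact h.nStar_anti hg (by positivity) le_rfl (remainingError_mem hβ _).1

lemma exists_essBound1_le (h : TiltedPairs f I0 I1) :
    ∃ C > 0, ∀ α ∈ Set.Ioo (0 : ℝ) 1, ∀ β ∈ Set.Ioo (0 : ℝ) 1, ∀ g > 0,
      essBound1 f α β (matchedSeq g α) (KHat1 f α β)
        ≤ nStar f (α / 4) g + (C * |Real.log (α / 4)| + 1) * (2 * g + 2 * α) := by
  obtain ⟨C, hC, H⟩ := h.exists_nStar_stage_le
  refine ⟨C, hC, fun α hα β hβ g hg => ?_⟩
  obtain ⟨H1, H2⟩ := H α hα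
  have hα0 := hα.1; have hα1 := hα.2; have hβ0 := hβ.1
  have hq : α / 4 ≤ 1 := by linarith
  refine (stages_bound_le (nn := fun j => nStar f ((α / 4) ^ j) (matchedSeq g α j))
    (B := C * |Real.log (α / 4)| + 1) hα hg (by positivity) (fun j hj => ?_)
    (H2 (KHat1 f α β) _ _ ?_)).trans ?_
  · rw [Finset.mem_Icc] at hj
    simp only [matchedSeq_of_pos g α hj.1]
    exact H1 j hj.1
  · refine (h.kHat1_spec hα hβ).2.imp_right fun hlt => ⟨?_, ?_⟩
    · exact pow_le_of_le_one (by positivity) hq (by omega)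
    · have h0 : 0 < (α / 4) ^ (KHat1 f α β + 1) := by positivity
      rw [pow_succ]
      nlinarith
  · rw [matchedSeq_zero]
    gcongr
    exact h.nStar_anti (by positivity) hg (remainingError_mem hα _).1 le_rfl

/-- The bound under the null is asymptotically `|log β| / I0` if `g → 0` and
`|log g| / |log β| → 0`. -/
lemma exists_essBound0_le_log (h : TiltedPairs f I0 I1) {ε : ℝ} (hε : 0 < ε) :
    ∃ δ ∈ Set.Ioo (0 : ℝ) 1, ∀ α ∈ Set.Ioo 0 δ, ∀ β ∈ Set.Ioo 0 δ, ∀ g ∈ Set.Ioo 0 δ,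
      |Real.log g| / |Real.log β| < δ →
      essBound0 f α β (matchedSeq g β) (KHat0 f α β) ≤ (1 + ε) * (|Real.log β| / I0) := by
  obtain ⟨C, hC, hbound⟩ := h.exists_essBound0_le
  obtain ⟨κ, hκ, hfirst⟩ := h.exists_nStar_le_null (by positivity : 0 < ε / 4)
  obtain ⟨δ, hδ, hlow⟩ := exists_lower_order_le h.null.pos hC hε
  refine ⟨min δ κ, ⟨lt_min hδ.1 hκ, (min_le_left _ _).trans_lt hδ.2⟩,
    fun α hα β hβ g hg hgβ => ?_⟩
  have hsub : ∀ {x}, x ∈ Set.Ioo 0 (min δ κ) → x ∈ Set.Ioo 0 δ := fun hx =>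
    ⟨hx.1, hx.2.trans_le (min_le_left _ _)⟩
  have hsub1 : ∀ {x}, x ∈ Set.Ioo 0 (min δ κ) → x ∈ Set.Ioo 0 1 := fun hx =>
    ⟨hx.1, (hsub hx).2.trans hδ.2⟩
  have hβ1 := hsub1 hβ
  have hL : 0 < |Real.log β| := abs_pos.2 (Real.log_neg hβ1.1 hβ1.2).ne
  have hgκ : |Real.log g| ≤ κ * |Real.log (β / 4)| := by
    rw [div_lt_iff₀ hL] at hgβ
    exact hgβ.le.trans
      (mul_le_mul (min_le_right _ _) (abs_log_div_four hβ1).1 (abs_nonneg _) hκ.le)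
  have h1 := hbound α (hsub1 hα) β hβ1 g hg.1
  have h2 := hfirst (β / 4) ⟨by linarith [hβ1.1], by linarith [hβ1.2]⟩ g (hsub1 hg) hgκ
  have h3 := hlow β (hsub hβ) g (hsub hg)
  linarith

lemma exists_essBound1_le_log (h : TiltedPairs f I0 I1) {ε : ℝ} (hε : 0 < ε) :
    ∃ δ ∈ Set.Ioo (0 : ℝ) 1, ∀ α ∈ Set.Ioo 0 δ, ∀ β ∈ Set.Ioo 0 δ, ∀ g ∈ Set.Ioo 0 δ,
      |Real.log g| / |Real.log α| < δ →
      essBound1 f α β (matchedSeq g α) (KHat1 f α β) ≤ (1 + ε) * (|Real.log α| / I1) := by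
  obtain ⟨C, hC, hbound⟩ := h.exists_essBound1_le
  obtain ⟨κ, hκ, hfirst⟩ := h.exists_nStar_le_alt (by positivity : 0 < ε / 4)
  obtain ⟨δ, hδ, hlow⟩ := exists_lower_order_le h.alt.pos hC hε
  refine ⟨min δ κ, ⟨lt_min hδ.1 hκ, (min_le_left _ _).trans_lt hδ.2⟩,
    fun α hα β hβ g hg hgα => ?_⟩
  have hsub : ∀ {x}, x ∈ Set.Ioo 0 (min δ κ) → x ∈ Set.Ioo 0 δ := fun hx =>
    ⟨hx.1, hx.2.trans_le (min_le_left _ _)⟩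
  have hsub1 : ∀ {x}, x ∈ Set.Ioo 0 (min δ κ) → x ∈ Set.Ioo 0 1 := fun hx =>
    ⟨hx.1, (hsub hx).2.trans hδ.2⟩
  have hα1 := hsub1 hα
  have hL : 0 < |Real.log α| := abs_pos.2 (Real.log_neg hα1.1 hα1.2).ne
  have hgκ : |Real.log g| ≤ κ * |Real.log (α / 4)| := by
    rw [div_lt_iff₀ hL] at hgα
    exact hgα.le.trans
      (mul_le_mul (min_le_right _ _) (abs_log_div_four hα1).1 (abs_nonneg _) hκ.le)
  have h1 := hbound α hα1 β (hsub1 hβ) g hg.1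
  have h2 := hfirst (α / 4) ⟨by linarith [hα1.1], by linarith [hα1.2]⟩ g (hsub1 hg) hgκ
  have h3 := hlow α (hsub hα) g (hsub hg)
  linarith

end TiltedPairs

lemma eventually_mem_Ioo_prod {δ : ℝ} (hδ : 0 < δ) :
    ∀ᶠ p : ℝ × ℝ in 𝓝[>] 0 ×ˢ 𝓝[>] 0, p.1 ∈ Set.Ioo 0 δ ∧ p.2 ∈ Set.Ioo 0 δ :=
  prod_mem_prod (Ioo_mem_nhdsGT hδ) (Ioo_mem_nhdsGT hδ)

lemma eventually_of_tendsto_smallOutside {M : ℝ → ℝ → Prop} {u : ℝ × ℝ → ℝ}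
    (h : Tendsto u (smallOutside M) (𝓝 0)) {δ : ℝ} (hδ : 0 < δ) :
    ∀ᶠ p : ℝ × ℝ in 𝓝[>] 0 ×ˢ 𝓝[>] 0, ¬ M p.1 p.2 → u p < δ :=
  eventually_inf_principal.1 (h.eventually_lt_const hδ)

namespace TiltedPairs

variable {f : Fin 2 → ProbDensity ν} {I0 I1 : ℝ}

lemma eventually_essBound0_le (h : TiltedPairs f I0 I1) {γ00 : ℝ → ℝ → ℝ}
    (hγ00 : ∀ α ∈ Set.Ioo (0 : ℝ) 1, ∀ β ∈ Set.Ioo (0 : ℝ) 1,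
      γ00 α β ∈ Set.Ioo (max (3 * α) β / 4) 1)
    (h0 : Tendsto (fun p : ℝ × ℝ => γ00 p.1 p.2)
      (smallOutside fun α β => MinimizesBound0 f α β (γ00 α β)) (𝓝 0))
    (h0' : Tendsto (fun p : ℝ × ℝ => |Real.log (γ00 p.1 p.2)| / |Real.log p.2|)
      (smallOutside fun α β => MinimizesBound0 f α β (γ00 α β)) (𝓝 0)) {ε : ℝ} (hε : 0 < ε) :
    ∀ᶠ p : ℝ × ℝ in 𝓝[>] 0 ×ˢ 𝓝[>] 0,
      essBound0 f p.1 p.2 (matchedSeq (γ00 p.1 p.2) p.2) (KHat0 f p.1 p.2)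
        ≤ (1 + ε) * (|Real.log p.2| / I0) := by
  obtain ⟨δ, hδ, H⟩ := h.exists_essBound0_le_log hε
  obtain ⟨δ', hδ', hcomp⟩ := exists_comparison hδ.1
  filter_upwards [eventually_mem_Ioo_prod hδ.1, eventually_mem_Ioo_prod hδ'.1,
    eventually_of_tendsto_smallOutside h0 hδ.1, eventually_of_tendsto_smallOutside h0' hδ.1]
    with ⟨α, β⟩ ⟨hα, hβ⟩ ⟨hα', hβ'⟩ hsmall hlog
  simp only at hα hβ hα' hβ' hsmall hlog ⊢
  have hpos : 0 ≤ max (3 * α) β / 4 := by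
    have := hβ.1
    positivity
  by_cases hM : MinimizesBound0 f α β (γ00 α β)
  -- Nothing is known about the size of a minimizer, but its bound is no larger than that at the
  -- comparison point.
  · obtain ⟨g, hg, hg1, hgδ, hglog⟩ := hcomp β hβ' α hα'
    exact le_trans (hM ⟨hg, hg1⟩) (H α hα β hβ g ⟨hpos.trans_lt hg, hgδ⟩ hglog)
  · have hγ := hγ00 α ⟨hα.1, hα.2.trans hδ.2⟩ β ⟨hβ.1, hβ.2.trans hδ.2⟩
    exact H α hα β hβ _ ⟨hpos.trans_lt hγ.1, hsmall hM⟩ (hlog hM)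

lemma eventually_essBound1_le (h : TiltedPairs f I0 I1) {γ10 : ℝ → ℝ → ℝ}
    (hγ10 : ∀ α ∈ Set.Ioo (0 : ℝ) 1, ∀ β ∈ Set.Ioo (0 : ℝ) 1,
      γ10 α β ∈ Set.Ioo (max α (3 * β) / 4) 1)
    (h1 : Tendsto (fun p : ℝ × ℝ => γ10 p.1 p.2)
      (smallOutside fun α β => MinimizesBound1 f α β (γ10 α β)) (𝓝 0))
    (h1' : Tendsto (fun p : ℝ × ℝ => |Real.log (γ10 p.1 p.2)| / |Real.log p.1|)
      (smallOutside fun α β => MinimizesBound1 f α β (γ10 α β)) (𝓝 0)) {ε : ℝ} (hε : 0 < ε) :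
    ∀ᶠ p : ℝ × ℝ in 𝓝[>] 0 ×ˢ 𝓝[>] 0,
      essBound1 f p.1 p.2 (matchedSeq (γ10 p.1 p.2) p.1) (KHat1 f p.1 p.2)
        ≤ (1 + ε) * (|Real.log p.1| / I1) := by
  obtain ⟨δ, hδ, H⟩ := h.exists_essBound1_le_log hε
  obtain ⟨δ', hδ', hcomp⟩ := exists_comparison hδ.1
  filter_upwards [eventually_mem_Ioo_prod hδ.1, eventually_mem_Ioo_prod hδ'.1,
    eventually_of_tendsto_smallOutside h1 hδ.1, eventually_of_tendsto_smallOutside h1' hδ.1]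
    with ⟨α, β⟩ ⟨hα, hβ⟩ ⟨hα', hβ'⟩ hsmall hlog
  simp only at hα hβ hα' hβ' hsmall hlog ⊢
  have hpos : 0 ≤ max α (3 * β) / 4 := by
    have := hα.1
    positivity
  by_cases hM : MinimizesBound1 f α β (γ10 α β)
  · obtain ⟨g, hg, hg1, hgδ, hglog⟩ := hcomp α hα' β hβ'
    rw [max_comm] at hg
    exact le_trans (hM ⟨hg, hg1⟩) (H α hα β hβ g ⟨hpos.trans_lt hg, hgδ⟩ hglog)
  · have hγ := hγ10 α ⟨hα.1, hα.2.trans hδ.2⟩ β ⟨hβ.1, hβ.2.trans hδ.2⟩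
    exact H α hα β hβ _ ⟨hpos.trans_lt hγ.1, hsmall hM⟩ (hlog hM)

lemma eventually_le_optSampleSize_null (h : TiltedPairs f I0 I1) {ε : ℝ} (hε : 0 < ε)
    (hε1 : ε < 1) :
    ∀ᶠ p : ℝ × ℝ in 𝓝[>] 0 ×ˢ 𝓝[>] 0,
      ENNReal.ofReal ((1 - ε) * (|Real.log p.2| / I0)) ≤ optSampleSize f 0 p.1 p.2 := by
  obtain ⟨δ, hδ, H⟩ := h.null.exists_le_lintegral_of_isTest hε hε1
  filter_upwards [eventually_mem_Ioo_prod hδ.1] with p hp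
  exact le_iInf₂ fun χ hχ =>
    H p.1 hp.1 p.2 hp.2 χ.1 χ.2 1 0 hχ.1 one_ne_zero hχ.2.1 hχ.2.2

lemma eventually_le_optSampleSize_alt (h : TiltedPairs f I0 I1) {ε : ℝ} (hε : 0 < ε)
    (hε1 : ε < 1) :
    ∀ᶠ p : ℝ × ℝ in 𝓝[>] 0 ×ˢ 𝓝[>] 0,
      ENNReal.ofReal ((1 - ε) * (|Real.log p.1| / I1)) ≤ optSampleSize f 1 p.1 p.2 := by
  obtain ⟨δ, hδ, H⟩ := h.alt.exists_le_lintegral_of_isTest hε hε1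
  filter_upwards [eventually_mem_Ioo_prod hδ.1] with p hp
  exact le_iInf₂ fun χ hχ =>
    H p.2 hp.2 p.1 hp.1 χ.1 χ.2 0 1 hχ.1 zero_ne_one hχ.2.2 hχ.2.1

end TiltedPairs

/-- Two functions that are both asymptotic to `s`, one of which dominates the other, have a ratio
that tends to one. -/
lemma tendsto_div_of_asymptotic {ι : Type*} {F : Filter ι} {u v : ι → ℝ≥0∞} {s : ι → ℝ}
    (hs : ∀ᶠ p in F, 0 < s p) (hvu : ∀ᶠ p in F, v p ≤ u p)
    (hu : ∀ ε > 0, ∀ᶠ p in F, u p ≤ ENNReal.ofReal ((1 + ε) * s p))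
    (hv : ∀ ε > 0, ε < 1 → ∀ᶠ p in F, ENNReal.ofReal ((1 - ε) * s p) ≤ v p) :
    Tendsto (fun p => u p / v p) F (𝓝 1) := by
  have hone : ∀ᶠ p in F, 1 ≤ u p / v p := by
    -- Any fixed values of `ε` will do here: they only ensure that `v p` is neither zero nor
    -- infinite.
    filter_upwards [hs, hvu, hu 1 one_pos, hv (1 / 2) (by norm_num) (by norm_num)]
      with p hsp hvu hu hv
    have hv0 : v p ≠ 0 := by
      refine (lt_of_lt_of_le ?_ hv).ne'
      rw [ENNReal.ofReal_pos]
      linarith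
    have hvt : v p ≠ ∞ := ne_top_of_le_ne_top ENNReal.ofReal_ne_top (hvu.trans hu)
    rw [ENNReal.le_div_iff_mul_le (Or.inl hv0) (Or.inl hvt), one_mul]
    exact hvu
  refine tendsto_order.2 ⟨fun a ha => hone.mono fun p hp => ha.trans_le hp, fun a ha => ?_⟩
  have hlim : Tendsto (fun ε : ℝ => ENNReal.ofReal ((1 + ε) / (1 - ε))) (𝓝[>] 0) (𝓝 1) := by
    have h1 : ContinuousAt (fun ε : ℝ => (1 + ε) / (1 - ε)) 0 :=
      ContinuousAt.div (by fun_prop) (by fun_prop) (by norm_num)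
    have h2 := ENNReal.tendsto_ofReal h1.tendsto
    simp only [add_zero, sub_zero, div_one, ENNReal.ofReal_one] at h2
    exact h2.mono_left nhdsWithin_le_nhds
  obtain ⟨ε, hεa, hε0, hε1⟩ := ((hlim.eventually_lt_const ha).and
    (Ioo_mem_nhdsGT (zero_lt_one' ℝ))).exists
  filter_upwards [hs, hu ε hε0, hv ε hε0 hε1] with p hsp hu hv
  have hpos : 0 < (1 - ε) * s p := mul_pos (by linarith) hsp
  refine lt_of_le_of_lt ?_ hεa
  calc u p / v p ≤ ENNReal.ofReal ((1 + ε) * s p) / ENNReal.ofReal ((1 - ε) * s p) :=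
        ENNReal.div_le_div hu hv
    _ = ENNReal.ofReal ((1 + ε) / (1 - ε)) := by
        rw [← ENNReal.ofReal_div_of_pos hpos, mul_div_mul_right _ _ hsp.ne']

end Asymptotics

theorem mainTheorem1 {S : Type*} [MeasurableSpace S] (ν : Measure S) [SigmaFinite ν]
    (f : Fin 2 → ProbDensity ν)
    (hI0 : InformationTheory.klDiv (f 0).law (f 1).law ∈ Set.Ioo 0 ∞)
    (hI1 : InformationTheory.klDiv (f 1).law (f 0).law ∈ Set.Ioo 0 ∞)
    (γ00 γ10 : ℝ → ℝ → ℝ)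
    (hγ00 : ∀ α ∈ Set.Ioo (0 : ℝ) 1, ∀ β ∈ Set.Ioo (0 : ℝ) 1,
      γ00 α β ∈ Set.Ioo (max (3 * α) β / 4) 1)
    (hγ10 : ∀ α ∈ Set.Ioo (0 : ℝ) 1, ∀ β ∈ Set.Ioo (0 : ℝ) 1,
      γ10 α β ∈ Set.Ioo (max α (3 * β) / 4) 1)
    -- at each pair `(α, β)` the value `γ00 α β` is a minimizer, or else it is chosen so that the
    -- following hold as `α, β → 0`
    (h0 : Tendsto (fun p : ℝ × ℝ => γ00 p.1 p.2)
      (smallOutside fun α β => MinimizesBound0 f α β (γ00 α β)) (𝓝 0))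
    (h0' : Tendsto (fun p : ℝ × ℝ => |Real.log (γ00 p.1 p.2)| / |Real.log p.2|)
      (smallOutside fun α β => MinimizesBound0 f α β (γ00 α β)) (𝓝 0))
    (h1 : Tendsto (fun p : ℝ × ℝ => γ10 p.1 p.2)
      (smallOutside fun α β => MinimizesBound1 f α β (γ10 α β)) (𝓝 0))
    (h1' : Tendsto (fun p : ℝ × ℝ => |Real.log (γ10 p.1 p.2)| / |Real.log p.1|)
      (smallOutside fun α β => MinimizesBound1 f α β (γ10 α β)) (𝓝 0)) :
    (∀ α ∈ Set.Ioo (0 : ℝ) 1, ∀ β ∈ Set.Ioo (0 : ℝ) 1,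
      (gmtHat f α β (γ00 α β) (γ10 α β)).IsAdmissible) ∧
    ∀ i : Fin 2, IsAsympOptimal f i
      (fun α β => (gmtHat f α β (γ00 α β) (γ10 α β)).test f) := by
  have h := tiltedPairs_of_klDiv hI0 hI1
  have hmem : ∀ α ∈ Set.Ioo (0 : ℝ) 1, ∀ β ∈ Set.Ioo (0 : ℝ) 1,
      (gmtHat f α β (γ00 α β) (γ10 α β)).test f ∈ testClass f α β := fun α hα β hβ =>
    h.test_gmtHat_mem_testClass hα hβ (hγ00 α hα β hβ) (hγ10 α hα β hβ)
  have hunit := eventually_mem_Ioo_prod (zero_lt_one' ℝ)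
  have hopt : ∀ i : Fin 2, ∀ᶠ p : ℝ × ℝ in 𝓝[>] 0 ×ˢ 𝓝[>] 0, optSampleSize f i p.1 p.2
      ≤ expSampleSize f i ((gmtHat f p.1 p.2 (γ00 p.1 p.2) (γ10 p.1 p.2)).test f).1 := fun i => by
    filter_upwards [hunit] with p hp
    exact iInf₂_le _ (hmem p.1 hp.1 p.2 hp.2)
  have hscale : ∀ {x I : ℝ}, x ∈ Set.Ioo (0 : ℝ) 1 → 0 < I → 0 < |Real.log x| / I :=
    fun hx hI => div_pos (abs_pos.2 (Real.log_neg hx.1 hx.2).ne) hI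
  refine ⟨fun α hα β hβ => h.isAdmissible_gmtHat hα hβ (hγ00 α hα β hβ) (hγ10 α hα β hβ),
    Fin.forall_fin_two.2 ⟨⟨hmem, ?_⟩, ⟨hmem, ?_⟩⟩⟩
  -- The common scale is `|log β| / I0`; in the second case it is `|log α| / I1`.
  · refine tendsto_div_of_asymptotic (hunit.mono fun p hp => hscale hp.2 h.null.pos) (hopt 0)
      (fun ε hε => ?_) fun ε hε hε1 => h.eventually_le_optSampleSize_null hε hε1
    filter_upwards [hunit, h.eventually_essBound0_le hγ00 h0 h0' hε] with p ⟨hα, hβ⟩ hp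
    have hγ := hγ00 p.1 hα p.2 hβ
    have := hβ.1
    exact (h.expSampleSize_null_le hβ ⟨lt_of_le_of_lt (by positivity) hγ.1, hγ.2⟩).trans
      (ENNReal.ofReal_le_ofReal hp)
  · refine tendsto_div_of_asymptotic (hunit.mono fun p hp => hscale hp.1 h.alt.pos) (hopt 1)
      (fun ε hε => ?_) fun ε hε hε1 => h.eventually_le_optSampleSize_alt hε hε1
    filter_upwards [hunit, h.eventually_essBound1_le hγ10 h1 h1' hε] with p ⟨hα, hβ⟩ hp
    have hγ := hγ10 p.1 hα p.2 hβ
    have := hα.1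
    exact (h.expSampleSize_alt_le hα ⟨lt_of_le_of_lt (by positivity) hγ.1, hγ.2⟩).trans
      (ENNReal.ofReal_le_ofReal hp)
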